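/- Let $M$ be a non-empty (pseudo-)Riemannian spin manifold of even dimension $2n$, $n\ge 1$, with metric $g$ having $t$ time-like directions. Spin structures are understood as structures for the group $\mathrm{Spin}$ of even products of vectors of spinor norm $+1$. Let $S$ be the bundle of complex Dirac spinors (rank $2^n$), with Clifford multiplication $\gamma$, $\gamma(X)\gamma(Y)+\gamma(Y)\gamma(X)=-2g(X,Y)$, and Levi-Civita connection $\nabla$. Let $C$ be a charge conjugation on $S$, i.e. a nondegenerate spin-invariant complex bilinear form with $C(\varphi,\psi)=\Delta_0C(\psi,\varphi)$ and $C(\varphi,\gamma_\mu\psi)=\Delta_1C(\psi,\gamma_\mu\varphi)$, where $\Delta_0,\Delta_1\in\{\pm1\}$. For a connection $D$ on $S$ let $D^C$ be the connection with $X(C(\varphi,\psi))=C(D_X\varphi,\psi)+C(\varphi,D^C_X\psi)$ and put $(\hat D_Z\gamma)(X)\xi=D_Z(\gamma(X)\xi)-\gamma(\nabla_ZX)\xi-\gamma(X)D^C_Z\xi$; $D$ is called admissible if $(\hat D_Z\gamma)(X)=-(\hat D_X\gamma)(Z)$ for all vector fields $X,Z$. Let $\gamma^*=\gamma^1\cdots\gamma^{2n}$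 if $2n-2t\equiv0\bmod 4$ and $\gamma^*=i\,\gamma^1\cdots\gamma^{2n}$ if $2n-2t\equiv2\bmod4$ (oriented orthonormal frames), and let $\Pi^\pm=\frac12(1\pm\gamma^*)$ be the projections of $S=S^+\oplus S^-$ onto $S^\pm$. For a smooth complex valued $\ell$-form $F$ put $\mathcal A^F_\mu=F_{\nu_1\dots\nu_\ell}\gamma^{\nu_1\dots\nu_\ell}\gamma_\mu\Pi^\pm$ (either sign, fixed). Let $(\ast)$ be the condition: $\ell\equiv3\bmod4$ if $n$ is odd, and $\ell\equiv1+\Delta_0\Delta_1\bmod4$ if $n$ is even. Then: (1) for every $\ell$-form $F$ whose contribution $\mathcal A^F$ does not vanish identically, the connection $D=\nabla+\mathcal A^F$ is admissible if and only if $(\ast)$ holds; (2) for $0\le\ell\le 2n$, the connection $\nabla+\mathcal A^F$ is admissible for all $\ell$-forms $F$ if and only if $(\ast)$ holds. -/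

import Mathlib

open Bundle Set
open scoped Manifold ContDiff Topology

noncomputable section

namespace SpinGeometry

/-! ### Algebraic model: signature, Clifford algebra, spinor module, charge conjugation -/

/-- The diagonal entries `g_{aa}` of the standard metric on `ℝ^{2n}` with `t` time-like
directions: `-1` for the first `t` directions and `+1` for the others. -/
def sgn (n t : ℕ) (a : Fin (2 * n)) : ℝ := if a.val < t then -1 else 1

/-- The quadratic form `v ↦ -g(v,v)` on `ℝ^{2n}`; in its Clifford algebra one has
`v w + w v = -2 g(v,w)`. -/
def cliffordForm (n t : ℕ) : QuadraticForm ℝ (Fin (2 * n) → ℝ) :=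
  QuadraticMap.weightedSumSquares ℝ (fun a => -sgn n t a)

/-- The real Clifford algebra of signature `(t, 2n - t)` with the convention `v² = -g(v,v)`. -/
abbrev Cl (n t : ℕ) : Type := CliffordAlgebra (cliffordForm n t)

/-- The space of (complex) Dirac spinors in dimension `2n`, of complex dimension `2^n`. -/
abbrev Spinor (n : ℕ) : Type := Fin (2 ^ n) → ℂ

/-- A spinor representation: a complex representation of the Clifford algebra on the space of Dirac
spinors. (As the dimension is `2^n`, it is irreducible, and any two of them are equivalent.) -/
abbrev SpinorRep (n t : ℕ) : Type := Cl n t →ₐ[ℝ] Module.End ℂ (Spinor n)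

/-- The Clifford action of a vector of `ℝ^{2n}` on spinors. -/
def SpinorRep.vec {n t : ℕ} (ρ : SpinorRep n t) :
    (Fin (2 * n) → ℝ) →ₗ[ℝ] Module.End ℂ (Spinor n) :=
  ρ.toLinearMap ∘ₗ CliffordAlgebra.ι (cliffordForm n t)

/-- `γ^a = g^{aa} γ_a`, the gamma matrix with upper index in the standard orthonormal basis. -/
def SpinorRep.gammaUp {n t : ℕ} (ρ : SpinorRep n t) (a : Fin (2 * n)) : Module.End ℂ (Spinor n) :=
  sgn n t a • ρ.vec (Pi.single a 1)

/-- `γ^{a₁⋯a_ℓ} = γ^{[a₁} ⋯ γ^{a_ℓ]}`, the skew symmetrised product (with weight `1/ℓ!`). -/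
def SpinorRep.gammaAlt {n t : ℕ} (ρ : SpinorRep n t) {ℓ : ℕ} (a : Fin ℓ → Fin (2 * n)) :
    Module.End ℂ (Spinor n) :=
  ((Nat.factorial ℓ : ℂ)⁻¹) • ∑ σ : Equiv.Perm (Fin ℓ),
    ((Equiv.Perm.sign σ : ℤ) : ℂ) • (List.ofFn fun k => ρ.gammaUp (a (σ k))).prod

/-- The chirality matrix `γ^*`: it is `γ^1 ⋯ γ^{2n}` if the signature `(2n - t) - t` of the metric
is `0` mod `4`, and `i γ^1 ⋯ γ^{2n}` if it is `2` mod `4`. -/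
def SpinorRep.gammaStar {n t : ℕ} (ρ : SpinorRep n t) : Module.End ℂ (Spinor n) :=
  (if ((2 * n : ℤ) - 2 * t) % 4 = 0 then (1 : ℂ) else Complex.I) •
    (List.ofFn fun a => ρ.gammaUp a).prod

/-- The chiral projection `Π^± = (1 ± γ^*) / 2` of `S = S⁺ ⊕ S⁻` onto `S^±`; the sign is given
by a unit of `ℤ`. -/
def SpinorRep.chiralProj {n t : ℕ} (ρ : SpinorRep n t) (ε : ℤˣ) : Module.End ℂ (Spinor n) :=
  (2 : ℂ)⁻¹ • (1 + ((ε : ℤ) : ℂ) • ρ.gammaStar)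

/-- `C` is a charge conjugation on the spinors: a nondegenerate spin-invariant complex bilinear
form such that `C(φ, ψ)` has symmetry `Δ₀ = ±1` and `C(φ, γ_μ ψ)` has symmetry `Δ₁ = ±1`. -/
structure IsChargeConjugation {n t : ℕ} (ρ : SpinorRep n t)
    (C : Spinor n →ₗ[ℂ] Spinor n →ₗ[ℂ] ℂ) (Δ₀ Δ₁ : ℤ) : Prop where
  nondegenerate : ∀ φ, (∀ ψ, C φ ψ = 0) → φ = 0
  spin_invariant : ∀ s ∈ spinGroup (cliffordForm n t), ∀ φ ψ, C (ρ s φ) (ρ s ψ) = C φ ψ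
  sign₀ : Δ₀ = 1 ∨ Δ₀ = -1
  sign₁ : Δ₁ = 1 ∨ Δ₁ = -1
  symm₀ : ∀ φ ψ, C φ ψ = (Δ₀ : ℂ) * C ψ φ
  symm₁ : ∀ v φ ψ, C φ (ρ.vec v ψ) = (Δ₁ : ℂ) * C ψ (ρ.vec v φ)

/-! ### Pseudo-Riemannian metrics and the Levi-Civita connection -/

/-- The model vector space of a `2n`-dimensional manifold. -/
abbrev E (n : ℕ) : Type := EuclideanSpace ℝ (Fin (2 * n))

/-- The model with corners of a `2n`-dimensional manifold without boundary. -/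
abbrev mdl (n : ℕ) : ModelWithCorners ℝ (E n) (E n) := 𝓘(ℝ, E n)

section Manifold

variable {n : ℕ} {M : Type*} [TopologicalSpace M] [ChartedSpace (E n) M]
  [IsManifold (mdl n) ∞ M]

/-- Smoothness of a vector field. -/
def IsSmoothVF (X : (x : M) → TangentSpace (mdl n) x) : Prop :=
  ContMDiff (mdl n) (mdl n).tangent ∞ (fun x => (⟨x, X x⟩ : TangentBundle (mdl n) M))

variable (n M) in
/-- A smooth pseudo-Riemannian metric on a `2n`-dimensional manifold. -/
structure PseudoRiemannianMetric where
  /-- the scalar product on the tangent spaces -/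
  val (x : M) : TangentSpace (mdl n) x →L[ℝ] TangentSpace (mdl n) x →L[ℝ] ℝ
  symm (x : M) (v w : TangentSpace (mdl n) x) : val x v w = val x w v
  nondegenerate (x : M) (v : TangentSpace (mdl n) x) : (∀ w, val x v w = 0) → v = 0
  contMDiff : ContMDiff (mdl n) ((mdl n).prod 𝓘(ℝ, E n →L[ℝ] E n →L[ℝ] ℝ)) ∞
    (fun x : M => TotalSpace.mk' (E n →L[ℝ] E n →L[ℝ] ℝ)
      (E := fun x : M => TangentSpace (mdl n) x →L[ℝ] TangentSpace (mdl n) x →L[ℝ] ℝ) x (val x))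

variable (n M) in
/-- Connections on the tangent bundle. -/
abbrev TangentConnection :=
  CovariantDerivative (mdl n) (E n) (fun x : M => TangentSpace (mdl n) x)

/-- `nab` is the Levi-Civita connection of `g`: the torsion free metric connection on `TM`.
Here `nab Y x (X x)` is `∇_X Y` at `x`. -/
structure IsLeviCivita (g : PseudoRiemannianMetric n M) (nab : TangentConnection n M) : Prop where
  torsion_free : ∀ (X Y : (x : M) → TangentSpace (mdl n) x) (x : M),
    MDifferentiableAt (mdl n) (mdl n).tangent
      (fun y => (⟨y, X y⟩ : TangentBundle (mdl n) M)) x →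
    MDifferentiableAt (mdl n) (mdl n).tangent
      (fun y => (⟨y, Y y⟩ : TangentBundle (mdl n) M)) x →
    nab Y x (X x) - nab X x (Y x) = VectorField.mlieBracket (mdl n) X Y x
  metric : ∀ (Y Z : (x : M) → TangentSpace (mdl n) x) (x : M),
    MDifferentiableAt (mdl n) (mdl n).tangent
      (fun y => (⟨y, Y y⟩ : TangentBundle (mdl n) M)) x →
    MDifferentiableAt (mdl n) (mdl n).tangent
      (fun y => (⟨y, Z y⟩ : TangentBundle (mdl n) M)) x →
    ∀ v : TangentSpace (mdl n) x,
    mvfderiv (mdl n) (fun y => g.val y (Y y) (Z y)) x v =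
      g.val x (nab Y x v) (Z x) + g.val x (Y x) (nab Z x v)

/-! ### Spin structures and the spinor bundle -/

/-- A spin structure on a `2n`-dimensional pseudo-Riemannian manifold with `t` time-like
directions, given by local orthonormal frames over an open cover together with a smooth cocycle
with values in the spin group which lifts the changes of frame. -/
structure SpinStructure (ι : Type*) (t : ℕ) (g : PseudoRiemannianMetric n M) where
  /-- the open sets of the cover -/
  baseSet : ι → Set M
  isOpen_baseSet : ∀ i, IsOpen (baseSet i)
  /-- for every point a member of the cover which contains it -/
  indexAt : M → ι
  mem_baseSet_at : ∀ x, x ∈ baseSet (indexAt x)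
  /-- the local frames; values outside of the base sets are irrelevant -/
  frame : ι → Fin (2 * n) → (x : M) → TangentSpace (mdl n) x
  contMDiffOn_frame : ∀ i a, ContMDiffOn (mdl n) (mdl n).tangent ∞
    (fun x => (⟨x, frame i a x⟩ : TangentBundle (mdl n) M)) (baseSet i)
  orthonormal : ∀ i, ∀ x ∈ baseSet i, ∀ a b,
    g.val x (frame i a x) (frame i b x) = if a = b then sgn n t a else 0
  /-- the cocycle of the spin structure -/
  trans : ι → ι → M → Cl n t
  trans_mem : ∀ i j, ∀ x ∈ baseSet i ∩ baseSet j, trans i j x ∈ spinGroup (cliffordForm n t)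
  trans_self : ∀ i, ∀ x ∈ baseSet i, trans i i x = 1
  trans_comp : ∀ i j k, ∀ x ∈ baseSet i ∩ baseSet j ∩ baseSet k,
    trans j k x * trans i j x = trans i k x
  /-- the cocycle is smooth as a function into the finite dimensional space `Cl n t` -/
  contMDiffOn_trans : ∀ i j (f : Cl n t →ₗ[ℝ] ℝ),
    ContMDiffOn (mdl n) 𝓘(ℝ, ℝ) ∞ (fun x => f (trans i j x)) (baseSet i ∩ baseSet j)
  /-- if a tangent vector has components `v` in the `i`-th and `w` in the `j`-th frame, then `w` is
  the image of `v` under the rotation covered by `trans i j`, i.e. `w = s v s⁻¹` -/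
  trans_covers : ∀ i j, ∀ x ∈ baseSet i ∩ baseSet j, ∀ v w : Fin (2 * n) → ℝ,
    ∑ a, v a • frame i a x = ∑ a, w a • frame j a x →
    trans i j x * CliffordAlgebra.ι (cliffordForm n t) v =
      CliffordAlgebra.ι (cliffordForm n t) w * trans i j x

namespace SpinStructure

variable {ι : Type*} {t : ℕ} {g : PseudoRiemannianMetric n M}

lemma contMDiffOn_coord (s : SpinStructure ι t g) (ρ : SpinorRep n t) (i j : ι) :
    ContMDiffOn (mdl n) 𝓘(ℝ, Spinor n →L[ℝ] Spinor n) ∞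
      (fun x => LinearMap.toContinuousLinearMap ((ρ (s.trans i j x)).restrictScalars ℝ))
      (s.baseSet i ∩ s.baseSet j) := by
  let L : Cl n t →ₗ[ℝ] (Spinor n →L[ℝ] Spinor n) :=
    { toFun := fun c => LinearMap.toContinuousLinearMap ((ρ c).restrictScalars ℝ)
      map_add' := fun a b => by ext v k; simp
      map_smul' := fun a b => by ext v k; simp }
  let b := Module.finBasis ℝ (Spinor n →L[ℝ] Spinor n)
  have h : ∀ c, L c = ∑ k, b.repr (L c) k • b k := fun c => (b.sum_repr (L c)).symm
  have h2 : ContMDiffOn (mdl n) 𝓘(ℝ, Spinor n →L[ℝ] Spinor n) ∞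
      (fun x => ∑ k, b.repr (L (s.trans i j x)) k • b k) (s.baseSet i ∩ s.baseSet j) := by
    refine contMDiffOn_finsetSum fun k _ => ?_
    exact (s.contMDiffOn_trans i j (b.coord k ∘ₗ L)).smul contMDiffOn_const
  exact h2.congr fun x _ => h _

/-- The spinor bundle, associated to the spin structure by the spinor representation. -/
def core (s : SpinStructure ι t g) (ρ : SpinorRep n t) : VectorBundleCore ℝ M (Spinor n) ι where
  baseSet := s.baseSet
  isOpen_baseSet := s.isOpen_baseSet
  indexAt := s.indexAt
  mem_baseSet_at := s.mem_baseSet_at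
  coordChange i j x := LinearMap.toContinuousLinearMap ((ρ (s.trans i j x)).restrictScalars ℝ)
  coordChange_self i x hx v := by simp [s.trans_self i x hx]
  continuousOn_coordChange i j := (s.contMDiffOn_coord ρ i j).continuousOn
  coordChange_comp i j k x hx v := by simp [← s.trans_comp i j k x hx]

instance (s : SpinStructure ι t g) (ρ : SpinorRep n t) : (s.core ρ).IsContMDiff (mdl n) ∞ :=
  ⟨s.contMDiffOn_coord ρ⟩

/-- The fibre `S_x` of the spinor bundle. It is a copy of `Spinor n`, through the trivialisation
with index `s.indexAt x`. -/
abbrev Fib (s : SpinStructure ι t g) (ρ : SpinorRep n t) (x : M) : Type := (s.core ρ).Fiber x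

/-- Smoothness of a section of the spinor bundle. -/
def IsSmoothSection (s : SpinStructure ι t g) (ρ : SpinorRep n t) (ψ : (x : M) → s.Fib ρ x) :
    Prop :=
  ContMDiff (mdl n) ((mdl n).prod 𝓘(ℝ, Spinor n)) ∞
    (fun x => (⟨x, ψ x⟩ : TotalSpace (Spinor n) (s.Fib ρ)))

/-- The components of a tangent vector at `x` in the frame with index `s.indexAt x`. -/
def comp (s : SpinStructure ι t g) (x : M) : TangentSpace (mdl n) x →ₗ[ℝ] (Fin (2 * n) → ℝ) :=
  LinearMap.pi fun a => sgn n t a • (g.val x (s.frame (s.indexAt x) a x)).toLinearMap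

/-- Clifford multiplication `γ : T_x M → End(S_x)`. -/
def gamma (s : SpinStructure ι t g) (ρ : SpinorRep n t) (x : M) :
    TangentSpace (mdl n) x →ₗ[ℝ] Module.End ℂ (Spinor n) :=
  ρ.vec ∘ₗ s.comp x

/-- The Clifford product `X φ = γ(X) φ` of a tangent vector and a spinor at `x`. -/
def cliff (s : SpinStructure ι t g) (ρ : SpinorRep n t) {x : M} (X : TangentSpace (mdl n) x)
    (φ : s.Fib ρ x) : s.Fib ρ x :=
  s.gamma ρ x X φ

/-- The connection one-form of the spin connection at `x` in the spin frame with index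
`s.indexAt x`: `X ↦ ¼ ∑_b γ^b γ(∇_X e_b)`. -/
def spinForm (s : SpinStructure ι t g) (ρ : SpinorRep n t) (nab : TangentConnection n M) (x : M) :
    TangentSpace (mdl n) x →ₗ[ℝ] Module.End ℂ (Spinor n) :=
  (4 : ℝ)⁻¹ • ∑ b, LinearMap.mulLeft ℝ (ρ.gammaUp b) ∘ₗ s.gamma ρ x ∘ₗ
    (nab (s.frame (s.indexAt x) b) x).toLinearMap

/-- The section `ψ` of the spinor bundle, read in the trivialisation with index
`s.indexAt x`. -/
def localRep (s : SpinStructure ι t g) (ρ : SpinorRep n t) (ψ : (x : M) → s.Fib ρ x) (x y : M) :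
    Spinor n :=
  (s.core ρ).coordChange (s.indexAt y) (s.indexAt x) y (ψ y)

instance (s : SpinStructure ι t g) (ρ : SpinorRep n t) (x : M) :
    IsTopologicalAddGroup (s.Fib ρ x) :=
  inferInstanceAs (IsTopologicalAddGroup (Spinor n))

instance (s : SpinStructure ι t g) (ρ : SpinorRep n t) (x : M) :
    ContinuousSMul ℝ (s.Fib ρ x) :=
  inferInstanceAs (ContinuousSMul ℝ (Spinor n))

/-- The one-form `X ↦ B(X) φ` with spinor values, for a spinor `φ`. -/
def applyForm {x : M} (B : TangentSpace (mdl n) x →ₗ[ℝ] Module.End ℂ (Spinor n)) (φ : Spinor n) :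
    TangentSpace (mdl n) x →L[ℝ] Spinor n :=
  (LinearMap.toContinuousLinearMap
    (((LinearMap.applyₗ φ).restrictScalars ℝ ∘ₗ B : TangentSpace (mdl n) x →ₗ[ℝ] Spinor n) :
      E n →ₗ[ℝ] Spinor n) : E n →L[ℝ] Spinor n)

/-- The same one-form, for a spinor at a point of the spinor bundle. -/
def applyFib (s : SpinStructure ι t g) (ρ : SpinorRep n t) {x : M}
    (B : TangentSpace (mdl n) x →ₗ[ℝ] Module.End ℂ (Spinor n)) (φ : s.Fib ρ x) :
    TangentSpace (mdl n) x →L[ℝ] s.Fib ρ x :=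
  applyForm B φ

/-- Connections on the spinor bundle. -/
abbrev SpinorConnection (s : SpinStructure ι t g) (ρ : SpinorRep n t) :=
  CovariantDerivative (mdl n) (Spinor n) (s.Fib ρ)

lemma mdifferentiableAt_localRep (s : SpinStructure ι t g) (ρ : SpinorRep n t)
    {ψ : (x : M) → s.Fib ρ x} {x : M}
    (h : MDifferentiableAt (mdl n) ((mdl n).prod 𝓘(ℝ, Spinor n))
      (fun y => (⟨y, ψ y⟩ : TotalSpace (Spinor n) (s.Fib ρ))) x) :
    MDifferentiableAt (mdl n) 𝓘(ℝ, Spinor n) (s.localRep ρ ψ x) x :=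
  (mdifferentiableAt_section _ ψ).1 h

/-- The Levi-Civita connection on the spinor bundle: in a spin frame
`∇_X ψ = X(ψ) + ¼ ∑_b γ^b γ(∇_X e_b) ψ`. -/
def leviCivita (s : SpinStructure ι t g) (ρ : SpinorRep n t) (nab : TangentConnection n M) :
    s.SpinorConnection ρ where
  toFun ψ x := (mvfderiv (mdl n) (s.localRep ρ ψ x) x + applyForm (s.spinForm ρ nab x) (ψ x) :
    TangentSpace (mdl n) x →L[ℝ] Spinor n)
  isCovariantDerivativeOnUniv :=
    { add := by
        intro σ σ' x hσ hσ' _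
        have e : s.localRep ρ (σ + σ') x = s.localRep ρ σ x + s.localRep ρ σ' x := by
          funext y
          exact map_add ((s.core ρ).coordChange (s.indexAt y) (s.indexAt x) y) (σ y) (σ' y)
        have h := mvfderiv_add (s.mdifferentiableAt_localRep ρ hσ)
          (s.mdifferentiableAt_localRep ρ hσ')
        have h2 : applyForm (s.spinForm ρ nab x) (σ x + σ' x : Spinor n) =
            applyForm (s.spinForm ρ nab x) (σ x) + applyForm (s.spinForm ρ nab x) (σ' x) := by
          ext1 X
          exact map_add (s.spinForm ρ nab x X) (σ x) (σ' x)
        refine (congrArg₂ (· + ·) ((congrArg (fun u => mvfderiv (mdl n) u x) e).trans h) h2).trans ?_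
        exact add_add_add_comm _ _ _ _
      leibniz := by
        intro σ f x hσ hf _
        have e : s.localRep ρ (f • σ) x = f • s.localRep ρ σ x := by
          funext y
          exact map_smul ((s.core ρ).coordChange (s.indexAt y) (s.indexAt x) y) (f y) (σ y)
        have h := mvfderiv_smul hf (s.mdifferentiableAt_localRep ρ hσ)
        have e' : s.localRep ρ σ x x = σ x :=
          (s.core ρ).coordChange_self _ x ((s.core ρ).mem_baseSet_at x) (σ x)
        rw [e'] at h
        have h2 : applyForm (s.spinForm ρ nab x) (f x • σ x : Spinor n) =
            f x • applyForm (s.spinForm ρ nab x) (σ x) := by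
          ext1 X
          exact ((s.spinForm ρ nab x X).restrictScalars ℝ).map_smul (f x) (σ x)
        refine (congrArg₂ (· + ·) ((congrArg (fun u => mvfderiv (mdl n) u x) e).trans h) h2).trans ?_
        ext1 X
        let φ : Spinor n := σ x
        change f x • mvfderiv (mdl n) (s.localRep ρ σ x) x X + mvfderiv (mdl n) f x X • φ +
          f x • applyForm (s.spinForm ρ nab x) φ X =
          f x • (mvfderiv (mdl n) (s.localRep ρ σ x) x X +
            applyForm (s.spinForm ρ nab x) φ X : Spinor n) + mvfderiv (mdl n) f x X • φ
        rw [smul_add]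
        exact add_right_comm _ _ _ }

/-- The connection `D + B` for an `End(S)`-valued one-form `B`. -/
def addForm {s : SpinStructure ι t g} {ρ : SpinorRep n t} (D : s.SpinorConnection ρ)
    (B : (x : M) → TangentSpace (mdl n) x →ₗ[ℝ] Module.End ℂ (Spinor n)) :
    s.SpinorConnection ρ where
  toFun ψ x := D ψ x + s.applyFib ρ (B x) (ψ x)
  isCovariantDerivativeOnUniv :=
    { add := by
        intro σ σ' x hσ hσ' _
        have h2 : s.applyFib ρ (B x) (σ x + σ' x) =
            s.applyFib ρ (B x) (σ x) + s.applyFib ρ (B x) (σ' x) := by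
          ext1 X
          exact map_add (B x X) (σ x) (σ' x)
        rw [D.isCovariantDerivativeOnUniv.add hσ hσ', Pi.add_apply, h2]
        exact add_add_add_comm _ _ _ _
      leibniz := by
        intro σ f x hσ hf _
        have h2 : s.applyFib ρ (B x) (f x • σ x) = f x • s.applyFib ρ (B x) (σ x) := by
          ext1 X
          exact ((B x X).restrictScalars ℝ).map_smul (f x) (σ x)
        rw [D.isCovariantDerivativeOnUniv.leibniz hσ hf, Pi.smul_apply', h2, smul_add]
        exact add_right_comm _ _ _ }

/-! ### Admissible connections -/

/-- `D'` is the connection `D^C` associated to `D`: the connection `D ⊗ 1 + 1 ⊗ D'` makes the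
charge conjugation parallel, i.e. `X(C(φ, ψ)) = C(D_X φ, ψ) + C(φ, D'_X ψ)`. (As `C` is
nondegenerate, this determines `D'` on smooth sections.) -/
def IsConjugate {s : SpinStructure ι t g} {ρ : SpinorRep n t}
    (C : Spinor n →ₗ[ℂ] Spinor n →ₗ[ℂ] ℂ) (D D' : s.SpinorConnection ρ) : Prop :=
  ∀ φ ψ : (x : M) → s.Fib ρ x, s.IsSmoothSection ρ φ → s.IsSmoothSection ρ ψ →
    ∀ (x : M) (X : TangentSpace (mdl n) x),
      mvfderiv (mdl n) (fun y => C (φ y) (ψ y)) x X = C (D φ x X) (ψ x) + C (φ x) (D' ψ x X)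

/-- `(\hat D_Z γ)(X) ξ = D_Z(γ(X) ξ) - γ(∇_Z X) ξ - γ(X) D^C_Z ξ`, where `D'` stands for
`D^C`. -/
def hatGamma {s : SpinStructure ι t g} {ρ : SpinorRep n t} (nab : TangentConnection n M)
    (D D' : s.SpinorConnection ρ) (Z X : (x : M) → TangentSpace (mdl n) x)
    (ξ : (x : M) → s.Fib ρ x) (x : M) : s.Fib ρ x :=
  D (fun y => s.cliff ρ (X y) (ξ y)) x (Z x) - s.cliff ρ (nab X x (Z x)) (ξ x) -
    s.cliff ρ (X x) (D' ξ x (Z x))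

/-- A connection `D` on the spinor bundle is admissible if `\hat D γ` is skew symmetric. -/
def IsAdmissible {s : SpinStructure ι t g} {ρ : SpinorRep n t} (nab : TangentConnection n M)
    (C : Spinor n →ₗ[ℂ] Spinor n →ₗ[ℂ] ℂ) (D : s.SpinorConnection ρ) : Prop :=
  ∃ D' : s.SpinorConnection ρ, IsConjugate C D D' ∧
    ∀ (Z X : (x : M) → TangentSpace (mdl n) x) (ξ : (x : M) → s.Fib ρ x),
      IsSmoothVF Z → IsSmoothVF X → s.IsSmoothSection ρ ξ →
      ∀ x, hatGamma nab D D' Z X ξ x = -hatGamma nab D D' X Z ξ x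

/-! ### The contribution of an `ℓ`-form -/

/-- The endomorphism `F_{a₁⋯a_ℓ} γ^{a₁⋯a_ℓ}` of `S_x`, for an `ℓ`-form `F` at `x`. -/
def formGamma (s : SpinStructure ι t g) (ρ : SpinorRep n t) {ℓ : ℕ} (x : M)
    (F : TangentSpace (mdl n) x [⋀^Fin ℓ]→ₗ[ℝ] ℂ) : Module.End ℂ (Spinor n) :=
  ∑ a : Fin ℓ → Fin (2 * n), F (fun k => s.frame (s.indexAt x) (a k) x) • ρ.gammaAlt a

/-- The `End(S)`-valued one-form `A_μ = F_{a₁⋯a_ℓ} γ^{a₁⋯a_ℓ} γ_μ Π^ε` defined by an `ℓ`-form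
`F`. -/
def contribution (s : SpinStructure ι t g) (ρ : SpinorRep n t) (ε : ℤˣ) {ℓ : ℕ}
    (F : (x : M) → TangentSpace (mdl n) x [⋀^Fin ℓ]→ₗ[ℝ] ℂ) (x : M) :
    TangentSpace (mdl n) x →ₗ[ℝ] Module.End ℂ (Spinor n) :=
  LinearMap.mulLeft ℝ (s.formGamma ρ x (F x)) ∘ₗ LinearMap.mulRight ℝ (ρ.chiralProj ε) ∘ₗ
    s.gamma ρ x

end SpinStructure

/-- Smoothness of a (complex valued) `ℓ`-form. -/
def IsSmoothForm {ℓ : ℕ} (F : (x : M) → TangentSpace (mdl n) x [⋀^Fin ℓ]→ₗ[ℝ] ℂ) : Prop :=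
  ∀ X : Fin ℓ → (x : M) → TangentSpace (mdl n) x, (∀ k, IsSmoothVF (X k)) →
    ContMDiff (mdl n) 𝓘(ℝ, ℂ) ∞ (fun x => F x (fun k => X k x))

end Manifold

end SpinGeometry

end

/-!
By Clifford multiplication `γ(Z) Π^ε = Π^{-ε} γ(Z)`, so `𝒜^F_Z = T γ(Z)` for the endomorphism
`T = F·γ Π^{-ε}`. The connection `∇` preserves the Clifford product and the charge conjugation, and
`γ(Z)` has the `C`-adjoint `Δ₀ Δ₁ γ(Z)`. Hence `(D̂_Z γ)(X) = T γ(Z) γ(X) + Δ₀ Δ₁ γ(X) γ(Z) T'`,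
where `T'` is the `C`-adjoint of `T`, and its symmetrisation in `X, Z` is
`-2 g(X, Z) (T + Δ₀ Δ₁ T')`. So admissibility means `T + Δ₀ Δ₁ T' = 0` at every point.

Reversing products of gamma matrices, the adjoint of `F·γ` is `(Δ₀ Δ₁)^ℓ (-1)^{ℓ(ℓ-1)/2} F·γ` and
that of `Π^ε` is `Π^{(-1)^n ε}`; therefore `T'` is a sign times `F·γ Π^{∓ε}` with the upper sign
if and only if `n + ℓ` is even. If `n + ℓ` is odd, then `T` and `T'` act on different
chiralities, and `T` has to vanish. If `n + ℓ` is even, either `T = 0` or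
`(Δ₀ Δ₁)^{ℓ + 1} (-1)^{ℓ(ℓ-1)/2} = -1`, which together with the parity is the condition `(∗)`.
-/

noncomputable section

namespace SpinGeometry

/-! ### Products of anticommuting elements -/

section Anticommuting

variable {R α : Type*} [Ring R]

lemma mul_prod_map_of_commute_up_to_sign {f : α → R} {s : α → ℤˣ} {x : R} {l : List α}
    (h : ∀ a ∈ l, x * f a = s a • (f a * x)) :
    x * (l.map f).prod = (l.map s).prod • ((l.map f).prod * x) := by
  induction l with
  | nil => simp
  | cons a l ih =>
    simp only [List.map_cons, List.prod_cons]
    rw [← mul_assoc, h a List.mem_cons_self, smul_mul_assoc, mul_assoc,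
      ih fun b hb => h b (List.mem_cons_of_mem _ hb), mul_smul_comm, smul_smul, mul_assoc]

lemma mul_prod_map_of_anticommute {f : α → R} {x : R} {l : List α}
    (h : ∀ a ∈ l, x * f a = -(f a * x)) :
    x * (l.map f).prod = (-1 : ℤˣ) ^ l.length • ((l.map f).prod * x) := by
  simpa using mul_prod_map_of_commute_up_to_sign (s := fun _ => -1) fun a ha => by
    rw [h a ha, Units.neg_smul, one_smul]

lemma mul_prod_ofFn_of_anticommute_of_even {m : ℕ} (hm : Even m) {f : Fin m → R}
    (h : ∀ i j, i ≠ j → f i * f j = -(f j * f i)) (i : Fin m) :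
    f i * (List.ofFn f).prod = -((List.ofFn f).prod * f i) := by
  have hcomm (j : Fin m) : f i * f j = (if j = i then (1 : ℤˣ) else -1) • (f j * f i) := by
    split_ifs with hj
    · rw [hj, one_smul]
    · rw [h i j (Ne.symm hj), Units.neg_smul, one_smul]
  have hsign : ∏ j, (if j = i then (1 : ℤˣ) else -1) = -1 := by
    rw [Finset.prod_ite, Finset.prod_const_one, one_mul, Finset.prod_const, Finset.filter_ne',
      Finset.card_erase_of_mem (Finset.mem_univ i), Finset.card_univ, Fintype.card_fin]
    exact (Nat.Even.sub_odd i.pos hm odd_one).neg_one_pow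
  rw [List.ofFn_eq_map, mul_prod_map_of_commute_up_to_sign fun j _ => hcomm j,
    ← List.ofFn_eq_map, List.prod_ofFn, hsign, Units.neg_smul, one_smul]

lemma prod_map_reverse_of_anticommute {f : α → R}
    (h : ∀ a b, a ≠ b → f a * f b = -(f b * f a)) {l : List α} (hl : l.Nodup) :
    (l.reverse.map f).prod = (-1 : ℤˣ) ^ l.length.choose 2 • (l.map f).prod := by
  induction l with
  | nil => simp
  | cons a l ih =>
    obtain ⟨ha, hl⟩ := List.nodup_cons.1 hl
    have hmul : f a * (l.map f).prod = (-1 : ℤˣ) ^ l.length • ((l.map f).prod * f a) :=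
      mul_prod_map_of_anticommute fun b hb => h a b fun e => ha (e ▸ hb)
    simp only [List.reverse_cons, List.map_append, List.prod_append, List.map_cons, List.map_nil,
      List.prod_cons, List.prod_nil, mul_one, List.length_cons]
    rw [ih hl, hmul, Nat.choose_succ_succ', Nat.choose_one_right, smul_smul, smul_mul_assoc,
      add_comm, pow_add, mul_assoc, ← mul_pow, neg_one_mul, neg_neg, one_pow, mul_one]

lemma prod_ofFn_comp_swap : ∀ (m : ℕ) (f : Fin (m + 1) → R)
    (_ : ∀ i j, i ≠ j → f i * f j = -(f j * f i)) (i : Fin m),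
    (List.ofFn (f ∘ Equiv.swap i.castSucc i.succ)).prod = -(List.ofFn f).prod
  | 0, _, _, i => i.elim0
  | m + 1, f, h, i => by
    refine Fin.cases ?_ (fun j => ?_) i
    · have htail : (fun k : Fin m => (f ∘ Equiv.swap (Fin.castSucc 0) (Fin.succ 0)) k.succ.succ) =
          fun k => f k.succ.succ := by
        funext k
        exact congrArg f (Equiv.swap_apply_of_ne_of_ne (Fin.succ_ne_zero _)
          fun e => Fin.succ_ne_zero _ (Fin.succ_injective _ e))
      rw [List.ofFn_succ, List.ofFn_succ, List.ofFn_succ (f := f), List.ofFn_succ, htail]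
      simp only [Function.comp_apply, List.prod_cons, Fin.castSucc_zero, Equiv.swap_apply_left,
        Equiv.swap_apply_right, ← mul_assoc]
      rw [h (Fin.succ 0) 0 (Fin.succ_ne_zero _), neg_mul]
    · have hhead : Equiv.swap j.succ.castSucc j.succ.succ 0 = 0 :=
        Equiv.swap_apply_of_ne_of_ne (by simp [Fin.ext_iff]) (by simp [Fin.ext_iff])
      have htail : (fun k : Fin (m + 1) => (f ∘ Equiv.swap j.succ.castSucc j.succ.succ) k.succ) =
          (fun k => f k.succ) ∘ Equiv.swap j.castSucc j.succ := by
        funext k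
        simp only [Function.comp_apply, Fin.castSucc_succ, (Fin.succ_injective _).swap_apply]
      rw [List.ofFn_succ, List.ofFn_succ (f := f), List.prod_cons, List.prod_cons, htail,
        prod_ofFn_comp_swap m _ (fun i j hij => h _ _ fun e => hij (Fin.succ_injective _ e)) j,
        Function.comp_apply, hhead, mul_neg]

lemma prod_ofFn_comp_perm {m : ℕ} (σ : Equiv.Perm (Fin m)) (f : Fin m → R)
    (h : ∀ i j, i ≠ j → f i * f j = -(f j * f i)) :
    (List.ofFn (f ∘ σ)).prod = Equiv.Perm.sign σ • (List.ofFn f).prod := by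
  cases m with
  | zero => simp [Subsingleton.elim σ 1]
  | succ m =>
    have hσ : σ ∈ Submonoid.closure
        (Set.range fun i : Fin m => Equiv.swap i.castSucc i.succ) := by
      rw [Equiv.Perm.mclosure_swap_castSucc_succ]; trivial
    induction hσ using Submonoid.closure_induction generalizing f with
    | mem x hx =>
      obtain ⟨i, rfl⟩ := hx
      rw [prod_ofFn_comp_swap m f h i, Equiv.Perm.sign_swap (Fin.castSucc_lt_succ).ne,
        Units.neg_smul, one_smul]
    | one => simp
    | mul x y _ _ hx hy =>
      rw [Equiv.Perm.coe_mul, ← Function.comp_assoc,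
        hy (f ∘ x) fun i j hij => h _ _ fun e => hij (x.injective e), hx f h, smul_smul, map_mul,
        mul_comm]

lemma prod_mul_prod_reverse_of_sq_eq {𝕜 : Type*} [CommRing 𝕜] [Algebra 𝕜 R] {f : α → R}
    {c : α → 𝕜} (h : ∀ a, f a * f a = algebraMap 𝕜 R (c a)) (l : List α) :
    (l.map f).prod * (l.reverse.map f).prod = algebraMap 𝕜 R (l.map c).prod := by
  induction l with
  | nil => simp
  | cons a l ih =>
    simp only [List.reverse_cons, List.map_append, List.prod_append, List.map_cons, List.map_nil,
      List.prod_cons, List.prod_nil, mul_one]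
    calc f a * (l.map f).prod * ((l.reverse.map f).prod * f a)
        = f a * ((l.map f).prod * (l.reverse.map f).prod) * f a := by simp only [mul_assoc]
      _ = algebraMap 𝕜 R (c a * (l.map c).prod) := by
        rw [ih, ← Algebra.commutes, mul_assoc, h, ← map_mul, mul_comm]

end Anticommuting

/-! ### Adjoints with respect to a bilinear form -/

section Adjoint

variable {R V : Type*} [CommRing R] [AddCommGroup V] [Module R V] {C : V →ₗ[R] V →ₗ[R] R}

/-- The endomorphism `B` is an adjoint of `A` on the right for the bilinear form `C`:
`C (A φ) ψ = C φ (B ψ)`. -/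
abbrev HasAdjoint (C : V →ₗ[R] V →ₗ[R] R) (A B : Module.End R V) : Prop :=
  LinearMap.IsAdjointPair C C A B

lemma HasAdjoint.one : HasAdjoint C 1 1 :=
  LinearMap.isAdjointPair_one

lemma HasAdjoint.add {A A' B B' : Module.End R V} (h : HasAdjoint C A B)
    (h' : HasAdjoint C A' B') : HasAdjoint C (A + A') (B + B') :=
  LinearMap.IsAdjointPair.add h h'

lemma HasAdjoint.smul {S : Type*} [CommSemiring S] [Algebra S R] [Module S V]
    [IsScalarTower S R V] [SMulCommClass R S V] {A B : Module.End R V} (h : HasAdjoint C A B)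
    (c : S) : HasAdjoint C (c • A) (c • B) := fun φ ψ => by
  rw [LinearMap.smul_apply, LinearMap.smul_apply, LinearMap.map_smul_of_tower,
    LinearMap.map_smul_of_tower, LinearMap.smul_apply, h φ ψ]

lemma HasAdjoint.sum {κ : Type*} {s : Finset κ} {A B : κ → Module.End R V}
    (h : ∀ k ∈ s, HasAdjoint C (A k) (B k)) : HasAdjoint C (∑ k ∈ s, A k) (∑ k ∈ s, B k) :=
  fun φ ψ => by
    simp only [LinearMap.sum_apply, map_sum]
    exact Finset.sum_congr rfl fun k hk => h k hk φ ψ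

lemma HasAdjoint.list_prod {κ : Type*} {A : κ → Module.End R V} {d : R}
    (h : ∀ k, HasAdjoint C (A k) (d • A k)) (l : List κ) :
    HasAdjoint C (l.map A).prod (d ^ l.length • (l.reverse.map A).prod) := by
  induction l with
  | nil => simpa using HasAdjoint.one
  | cons a l ih =>
    simpa only [List.map_cons, List.prod_cons, List.length_cons, List.reverse_cons,
      List.map_append, List.prod_append, List.map_nil, List.prod_nil, mul_one,
      smul_mul_smul_comm, ← pow_succ] using LinearMap.IsAdjointPair.mul (h a) ih

lemma HasAdjoint.unique (hC : C.SeparatingRight) {A B B' : Module.End R V}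
    (h : HasAdjoint C A B) (h' : HasAdjoint C A B') : B = B' := by
  refine LinearMap.ext fun ψ => sub_eq_zero.1 (hC _ fun φ => ?_)
  rw [map_sub, ← h φ ψ, h' φ ψ, sub_self]

end Adjoint

/-! ### Gamma matrices and chirality -/

section Gamma

variable {n t : ℕ}

lemma sgn_mul_self (a : Fin (2 * n)) : sgn n t a * sgn n t a = 1 := by
  unfold sgn; split_ifs <;> norm_num

lemma prod_sgn (ht : t ≤ 2 * n) : ∏ a, sgn n t a = (-1) ^ t := by
  have hfilter : (Finset.range (2 * n)).filter (· < t) = Finset.range t := by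
    ext k; simp; omega
  unfold sgn
  rw [Fin.prod_univ_eq_prod_range (fun k => if k < t then (-1 : ℝ) else 1) (2 * n),
    Finset.prod_ite, Finset.prod_const, Finset.prod_const_one, mul_one, hfilter, Finset.card_range]

lemma even_choose_two_iff : ∀ m : ℕ, Even (m.choose 2) ↔ m % 4 < 2
  | 0 | 1 | 2 | 3 => by decide
  | m + 4 => by
    have hchoose : (m + 4).choose 2 = m.choose 2 + 2 * (2 * m + 3) := by
      simp only [Nat.choose_succ_succ' _ 1, Nat.choose_one_right]
      ring
    rw [hchoose, Nat.even_add, iff_true_right (even_two_mul _), even_choose_two_iff m,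
      Nat.add_mod_right]

lemma neg_one_pow_choose_two_mul {R : Type*} [Monoid R] [HasDistribNeg R] (n : ℕ) :
    (-1 : R) ^ (2 * n).choose 2 = (-1) ^ n :=
  neg_one_pow_congr (by rw [even_choose_two_iff, Nat.even_iff]; omega)

lemma polar_cliffordForm_single (a b : Fin (2 * n)) :
    QuadraticMap.polar (cliffordForm n t) (Pi.single a 1) (Pi.single b 1) =
      if a = b then -2 * sgn n t a else 0 := by
  have hpolar (v w : Fin (2 * n) → ℝ) :
      QuadraticMap.polar (cliffordForm n t) v w = ∑ c, -2 * sgn n t c * (v c * w c) := by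
    simp only [QuadraticMap.polar, cliffordForm, QuadraticMap.weightedSumSquares_apply,
      ← Finset.sum_sub_distrib, smul_eq_mul, Pi.add_apply]
    exact Finset.sum_congr rfl fun c _ => by ring
  rw [hpolar, Finset.sum_eq_single a (fun c _ hc => by simp [hc]) (by simp)]
  simp [Pi.single_apply]

namespace SpinorRep

variable (ρ : SpinorRep n t)

lemma vec_mul_vec_add (v w : Fin (2 * n) → ℝ) :
    ρ.vec v * ρ.vec w + ρ.vec w * ρ.vec v =
      algebraMap ℝ _ (QuadraticMap.polar (cliffordForm n t) v w) := by
  have hι := congrArg ρ (CliffordAlgebra.ι_mul_ι_add_swap (Q := cliffordForm n t) v w)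
  rwa [map_add, map_mul, map_mul, AlgHom.commutes] at hι

lemma gammaUp_mul_gammaUp_of_ne {a b : Fin (2 * n)} (h : a ≠ b) :
    ρ.gammaUp a * ρ.gammaUp b = -(ρ.gammaUp b * ρ.gammaUp a) := by
  have hvec := ρ.vec_mul_vec_add (Pi.single a 1) (Pi.single b 1)
  rw [polar_cliffordForm_single, if_neg h, map_zero] at hvec
  simp only [gammaUp, smul_mul_smul_comm]
  rw [eq_neg_of_add_eq_zero_left hvec, mul_comm, smul_neg]

lemma gammaUp_mul_self (a : Fin (2 * n)) :
    ρ.gammaUp a * ρ.gammaUp a = algebraMap ℝ _ (-sgn n t a) := by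
  have hvec := ρ.vec_mul_vec_add (Pi.single a 1) (Pi.single a 1)
  rw [polar_cliffordForm_single, if_pos rfl, neg_mul, ← mul_neg, map_mul, map_ofNat, ← two_mul]
    at hvec
  have hsq : ρ.vec (Pi.single a 1) * ρ.vec (Pi.single a 1) = algebraMap ℝ _ (-sgn n t a) := by
    have h2 : IsUnit (algebraMap ℝ (Module.End ℂ (Spinor n)) 2) :=
      (isUnit_iff_ne_zero.2 two_ne_zero).map _
    rw [map_ofNat] at h2
    exact h2.mul_left_cancel hvec
  rw [gammaUp, smul_mul_smul_comm, sgn_mul_self, one_smul, hsq]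

lemma vec_eq_sum (v : Fin (2 * n) → ℝ) :
    ρ.vec v = ∑ a, (sgn n t a * v a) • ρ.gammaUp a := by
  conv_lhs => rw [pi_eq_sum_univ' v, map_sum]
  refine Finset.sum_congr rfl fun a _ => ?_
  rw [map_smul, gammaUp, smul_smul, mul_right_comm, sgn_mul_self, one_mul]

/-- The product `γ^{a₁} ⋯ γ^{a_ℓ}` of gamma matrices, without skew symmetrisation. -/
def gammaProd {ℓ : ℕ} (a : Fin ℓ → Fin (2 * n)) : Module.End ℂ (Spinor n) :=
  (List.ofFn fun k => ρ.gammaUp (a k)).prod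

lemma gammaProd_eq_prod_map {ℓ : ℕ} (a : Fin ℓ → Fin (2 * n)) :
    ρ.gammaProd a = ((List.ofFn a).map ρ.gammaUp).prod := by
  rw [gammaProd, List.map_ofFn]; rfl

lemma gammaProd_comp_perm {ℓ : ℕ} {a : Fin ℓ → Fin (2 * n)} (ha : Function.Injective a)
    (σ : Equiv.Perm (Fin ℓ)) :
    ρ.gammaProd (a ∘ σ) = Equiv.Perm.sign σ • ρ.gammaProd a :=
  prod_ofFn_comp_perm σ (fun k => ρ.gammaUp (a k)) fun _ _ hij =>
    ρ.gammaUp_mul_gammaUp_of_ne fun e => hij (ha e)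

lemma prod_map_reverse_eq_smul_gammaProd {ℓ : ℕ} {a : Fin ℓ → Fin (2 * n)}
    (ha : Function.Injective a) :
    ((List.ofFn a).reverse.map ρ.gammaUp).prod = (-1 : ℤˣ) ^ ℓ.choose 2 • ρ.gammaProd a := by
  rw [prod_map_reverse_of_anticommute (fun _ _ h => ρ.gammaUp_mul_gammaUp_of_ne h)
    (List.nodup_ofFn.2 ha), List.length_ofFn, gammaProd_eq_prod_map]

lemma isUnit_gammaUp (a : Fin (2 * n)) : IsUnit (ρ.gammaUp a) := by
  have hsgn : IsUnit (-sgn n t a) :=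
    IsUnit.of_mul_eq_one (-sgn n t a) (by rw [neg_mul_neg, sgn_mul_self])
  have hsq : IsUnit (ρ.gammaUp a * ρ.gammaUp a) := by
    rw [gammaUp_mul_self]
    exact hsgn.map _
  exact ((Commute.refl _).isUnit_mul_iff.1 hsq).1

lemma isUnit_gammaProd {ℓ : ℕ} (a : Fin ℓ → Fin (2 * n)) : IsUnit (ρ.gammaProd a) :=
  List.prod_isUnit fun A hA => by
    obtain ⟨k, rfl⟩ := (List.mem_ofFn' _ _).1 hA
    exact ρ.isUnit_gammaUp (a k)

lemma gammaProd_id_mul_self (ht : t ≤ 2 * n) :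
    ρ.gammaProd id * ρ.gammaProd id = (-1 : ℤˣ) ^ (n + t) • 1 := by
  have hmul := prod_mul_prod_reverse_of_sq_eq ρ.gammaUp_mul_self (List.ofFn id)
  have hsgn : ((List.ofFn id).map fun a => -sgn n t a).prod = (-1) ^ t := by
    rw [List.map_ofFn, List.prod_ofFn]
    simp [Finset.prod_neg, prod_sgn ht]
  rw [prod_map_reverse_eq_smul_gammaProd ρ Function.injective_id, ← gammaProd_eq_prod_map, hsgn,
    neg_one_pow_choose_two_mul, mul_smul_comm, map_pow, map_neg, map_one] at hmul
  calc ρ.gammaProd id * ρ.gammaProd id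
      = (-1 : ℤˣ) ^ n • (-1 : ℤˣ) ^ n • (ρ.gammaProd id * ρ.gammaProd id) := by
        rw [smul_smul, ← mul_pow]; simp
    _ = (-1 : ℤˣ) ^ (n + t) • 1 := by
        rw [hmul, pow_add, ← smul_smul, Units.smul_def ((-1) ^ t)]; simp

lemma gammaStar_mul_self (ht : t ≤ 2 * n) : ρ.gammaStar * ρ.gammaStar = 1 := by
  change (_ • ρ.gammaProd id) * (_ • ρ.gammaProd id) = 1
  rw [smul_mul_smul_comm, ρ.gammaProd_id_mul_self ht]
  split_ifs with h
  · rw [Even.neg_one_pow (by grind)]; simp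
  · rw [Odd.neg_one_pow (by grind)]; simp

lemma vec_mul_gammaStar (v : Fin (2 * n) → ℝ) :
    ρ.vec v * ρ.gammaStar = -(ρ.gammaStar * ρ.vec v) := by
  have hgamma (a : Fin (2 * n)) :
      ρ.gammaUp a * ρ.gammaStar = -(ρ.gammaStar * ρ.gammaUp a) := by
    rw [gammaStar, mul_smul_comm, smul_mul_assoc,
      mul_prod_ofFn_of_anticommute_of_even (even_two_mul n)
        (fun _ _ h => ρ.gammaUp_mul_gammaUp_of_ne h), smul_neg]
  simp only [vec_eq_sum, Finset.sum_mul, Finset.mul_sum, smul_mul_assoc, mul_smul_comm, hgamma,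
    smul_neg, Finset.sum_neg_distrib]

lemma vec_mul_chiralProj (ε : ℤˣ) (v : Fin (2 * n) → ℝ) :
    ρ.vec v * ρ.chiralProj ε = ρ.chiralProj (-ε) * ρ.vec v := by
  simp only [chiralProj, mul_smul_comm, smul_mul_assoc, mul_add, add_mul, mul_one, one_mul,
    vec_mul_gammaStar, Units.val_neg, Int.cast_neg]
  module

lemma gammaUp_mul_chiralProj (ε : ℤˣ) (a : Fin (2 * n)) :
    ρ.gammaUp a * ρ.chiralProj ε = ρ.chiralProj (-ε) * ρ.gammaUp a := by
  rw [gammaUp, smul_mul_assoc, vec_mul_chiralProj, mul_smul_comm]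

lemma gammaProd_mul_chiralProj (ε : ℤˣ) {ℓ : ℕ} (a : Fin ℓ → Fin (2 * n)) :
    ρ.gammaProd a * ρ.chiralProj ε = ρ.chiralProj ((-1) ^ ℓ * ε) * ρ.gammaProd a := by
  have hlist (l : List (Fin (2 * n))) : (l.map ρ.gammaUp).prod * ρ.chiralProj ε =
      ρ.chiralProj ((-1) ^ l.length * ε) * (l.map ρ.gammaUp).prod := by
    induction l with
    | nil => simp
    | cons b l ih =>
      rw [List.map_cons, List.prod_cons, mul_assoc, ih, ← mul_assoc, gammaUp_mul_chiralProj,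
        mul_assoc, List.length_cons, pow_succ, mul_neg_one, neg_mul]
  rw [gammaProd_eq_prod_map, hlist, List.length_ofFn]

lemma chiralProj_mul_self (ht : t ≤ 2 * n) (ε : ℤˣ) :
    ρ.chiralProj ε * ρ.chiralProj ε = ρ.chiralProj ε := by
  have hε : (((ε : ℤ) : ℂ)) * ((ε : ℤ) : ℂ) = 1 := by
    rcases Int.units_eq_one_or ε with rfl | rfl <;> simp
  simp only [chiralProj, smul_mul_smul_comm, mul_add, add_mul, mul_one, one_mul,
    ρ.gammaStar_mul_self ht, hε, one_smul]
  module

lemma chiralProj_add_neg (ε : ℤˣ) : ρ.chiralProj ε + ρ.chiralProj (-ε) = 1 := by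
  simp only [chiralProj, Units.val_neg, Int.cast_neg]
  module

lemma chiralProj_neg_mul (ht : t ≤ 2 * n) (ε : ℤˣ) :
    ρ.chiralProj (-ε) * ρ.chiralProj ε = 0 := by
  rw [eq_sub_of_add_eq' (ρ.chiralProj_add_neg ε), sub_mul, one_mul,
    ρ.chiralProj_mul_self ht, sub_self]

lemma chiralProj_ne_zero [NeZero n] (ε : ℤˣ) : ρ.chiralProj ε ≠ 0 := by
  intro h
  have hgamma := ρ.isUnit_gammaUp 0
  have hneg : ρ.chiralProj (-ε) = 0 := hgamma.mul_left_eq_zero.1 <| by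
    rw [← gammaUp_mul_chiralProj, h, mul_zero]
  have hone := ρ.chiralProj_add_neg ε
  rw [h, hneg, add_zero] at hone
  exact zero_ne_one hone

lemma sum_smul_gammaAlt {ℓ : ℕ} {f : (Fin ℓ → Fin (2 * n)) → ℂ}
    (hf : ∀ a (σ : Equiv.Perm (Fin ℓ)), f (a ∘ σ) = ((Equiv.Perm.sign σ : ℤ) : ℂ) * f a) :
    ∑ a, f a • ρ.gammaAlt a = ∑ a, f a • ρ.gammaProd a := by
  have hperm (σ : Equiv.Perm (Fin ℓ)) :
      ∑ a, f a • ((Equiv.Perm.sign σ : ℤ) : ℂ) • ρ.gammaProd (a ∘ σ) =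
        ∑ a, f a • ρ.gammaProd a := by
    rw [← Equiv.sum_comp (Equiv.arrowCongr σ.symm (Equiv.refl (Fin (2 * n))))
      fun a => f a • ρ.gammaProd a]
    refine Finset.sum_congr rfl fun a _ => ?_
    change _ = f (a ∘ σ) • ρ.gammaProd (a ∘ σ)
    rw [hf, smul_smul, mul_comm]
  have hterm (a : Fin ℓ → Fin (2 * n)) :
      f a • ρ.gammaAlt a = (Nat.factorial ℓ : ℂ)⁻¹ • ∑ σ : Equiv.Perm (Fin ℓ),
        f a • ((Equiv.Perm.sign σ : ℤ) : ℂ) • ρ.gammaProd (a ∘ σ) := by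
    rw [gammaAlt, smul_comm, Finset.smul_sum]
    rfl
  simp only [hterm]
  rw [← Finset.smul_sum, Finset.sum_comm, Finset.sum_congr rfl fun σ _ => hperm σ, Finset.sum_const,
    Finset.card_univ, Fintype.card_perm, Fintype.card_fin, ← Nat.cast_smul_eq_nsmul ℂ, smul_smul,
    inv_mul_cancel₀ (Nat.cast_ne_zero.2 (Nat.factorial_ne_zero ℓ)), one_smul]

end SpinorRep

end Gamma

/-! ### Adjoints with respect to a charge conjugation -/

section Adjoints

variable {n t : ℕ} {ρ : SpinorRep n t} {C : Spinor n →ₗ[ℂ] Spinor n →ₗ[ℂ] ℂ} {Δ₀ Δ₁ : ℤ}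

namespace IsChargeConjugation

lemma separatingRight (hC : IsChargeConjugation ρ C Δ₀ Δ₁) : C.SeparatingRight := fun ψ h =>
  hC.nondegenerate ψ fun φ => by rw [hC.symm₀, h, mul_zero]

lemma sign_mul_eq (hC : IsChargeConjugation ρ C Δ₀ Δ₁) : Δ₀ * Δ₁ = 1 ∨ Δ₀ * Δ₁ = -1 := by
  rcases hC.sign₀ with rfl | rfl <;> rcases hC.sign₁ with rfl | rfl <;> norm_num

lemma sign_mul_sq (hC : IsChargeConjugation ρ C Δ₀ Δ₁) : ((Δ₀ * Δ₁ : ℤ) : ℂ) ^ 2 = 1 := by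
  rcases hC.sign_mul_eq with h | h <;> rw [h] <;> norm_num

lemma hasAdjoint_vec (hC : IsChargeConjugation ρ C Δ₀ Δ₁) (v : Fin (2 * n) → ℝ) :
    HasAdjoint C (ρ.vec v) (((Δ₀ * Δ₁ : ℤ) : ℂ) • ρ.vec v) := fun φ ψ => by
  rw [hC.symm₀, hC.symm₁, LinearMap.smul_apply, map_smul, Int.cast_mul, smul_eq_mul, mul_assoc]

lemma hasAdjoint_gammaUp (hC : IsChargeConjugation ρ C Δ₀ Δ₁) (a : Fin (2 * n)) :
    HasAdjoint C (ρ.gammaUp a) (((Δ₀ * Δ₁ : ℤ) : ℂ) • ρ.gammaUp a) := by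
  rw [SpinorRep.gammaUp, ← map_smul]
  exact hC.hasAdjoint_vec _

lemma hasAdjoint_gammaProd (hC : IsChargeConjugation ρ C Δ₀ Δ₁) {ℓ : ℕ}
    {a : Fin ℓ → Fin (2 * n)} (ha : Function.Injective a) :
    HasAdjoint C (ρ.gammaProd a)
      ((((Δ₀ * Δ₁ : ℤ) : ℂ) ^ ℓ * (-1) ^ ℓ.choose 2) • ρ.gammaProd a) := by
  have hprod := HasAdjoint.list_prod hC.hasAdjoint_gammaUp (List.ofFn a)
  have hsign : (-1 : ℤˣ) ^ ℓ.choose 2 • ρ.gammaProd a = (-1 : ℂ) ^ ℓ.choose 2 • ρ.gammaProd a := by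
    rcases (ℓ.choose 2).even_or_odd with h | h
    · rw [h.neg_one_pow, h.neg_one_pow, one_smul, one_smul]
    · rw [h.neg_one_pow, h.neg_one_pow, Units.neg_smul, one_smul]
      exact (neg_one_smul ℂ _).symm
  rwa [ρ.prod_map_reverse_eq_smul_gammaProd ha, ← ρ.gammaProd_eq_prod_map, List.length_ofFn,
    hsign, smul_smul] at hprod

lemma hasAdjoint_sum_gammaProd (hC : IsChargeConjugation ρ C Δ₀ Δ₁) {ℓ : ℕ}
    {f : (Fin ℓ → Fin (2 * n)) → ℂ} (hf : ∀ a, ¬ Function.Injective a → f a = 0) :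
    HasAdjoint C (∑ a, f a • ρ.gammaProd a)
      ((((Δ₀ * Δ₁ : ℤ) : ℂ) ^ ℓ * (-1) ^ ℓ.choose 2) • ∑ a, f a • ρ.gammaProd a) := by
  rw [Finset.smul_sum]
  refine HasAdjoint.sum fun a _ => ?_
  by_cases ha : Function.Injective a
  · rw [smul_comm]
    exact (hC.hasAdjoint_gammaProd ha).smul _
  · rw [hf a ha, zero_smul, smul_zero]
    exact LinearMap.isAdjointPair_zero

lemma hasAdjoint_gammaStar (hC : IsChargeConjugation ρ C Δ₀ Δ₁) :
    HasAdjoint C ρ.gammaStar ((-1 : ℂ) ^ n • ρ.gammaStar) := by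
  have hprod := hC.hasAdjoint_gammaProd (a := (id : Fin (2 * n) → Fin (2 * n)))
    Function.injective_id
  rw [neg_one_pow_choose_two_mul, pow_mul, hC.sign_mul_sq, one_pow, one_mul] at hprod
  rw [SpinorRep.gammaStar, smul_comm]
  exact hprod.smul _

lemma hasAdjoint_chiralProj (hC : IsChargeConjugation ρ C Δ₀ Δ₁) (ε : ℤˣ) :
    HasAdjoint C (ρ.chiralProj ε) (ρ.chiralProj ((-1) ^ n * ε)) := by
  simpa [SpinorRep.chiralProj, smul_smul, mul_comm] using
    (HasAdjoint.one.add (hC.hasAdjoint_gammaStar.smul ((ε : ℤ) : ℂ))).smul (2 : ℂ)⁻¹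

end IsChargeConjugation

/-! ### The degrees of admissible forms -/

/-- Condition `(∗)` on the degree `ℓ` of a form in dimension `2n`, where `d` stands for
`Δ₀ Δ₁`. -/
def IsAdmissibleDegree (n ℓ : ℕ) (d : ℤ) : Prop :=
  (Odd n ∧ (ℓ : ℤ) ≡ 3 [ZMOD 4]) ∨ (Even n ∧ (ℓ : ℤ) ≡ 1 + d [ZMOD 4])

lemma isAdmissibleDegree_iff {ℓ : ℕ} {d : ℤ} (hd : d = 1 ∨ d = -1) :
    IsAdmissibleDegree n ℓ d ↔ Even (n + ℓ) ∧ d ^ (ℓ + 1) * (-1) ^ ℓ.choose 2 = -1 := by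
  have hsign : d ^ (ℓ + 1) * (-1) ^ ℓ.choose 2 = -1 ↔
      (d = 1 ∧ 2 ≤ ℓ % 4) ∨ (d = -1 ∧ (ℓ % 4 = 0 ∨ ℓ % 4 = 3)) := by
    have hchoose := even_choose_two_iff ℓ
    rcases hd with rfl | rfl
    · rw [one_pow, one_mul, neg_one_pow_eq_neg_one_iff_odd (by norm_num), ← Nat.not_even_iff_odd,
        hchoose]
      omega
    · rw [← pow_add, neg_one_pow_eq_neg_one_iff_odd (by norm_num), Nat.odd_add, hchoose,
        Nat.odd_iff]
      omega
  rw [hsign, IsAdmissibleDegree]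
  simp only [Int.ModEq, Nat.odd_iff, Nat.even_iff]
  rcases hd with rfl | rfl <;> omega

lemma mul_chiralProj_add_hasAdjoint_eq_zero_iff (hC : IsChargeConjugation ρ C Δ₀ Δ₁)
    (ht : t ≤ 2 * n) (ε : ℤˣ) {ℓ : ℕ} {S T : Module.End ℂ (Spinor n)}
    (hS : HasAdjoint C S ((((Δ₀ * Δ₁ : ℤ) : ℂ) ^ ℓ * (-1) ^ ℓ.choose 2) • S))
    (hSP : ∀ ε, S * ρ.chiralProj ε = ρ.chiralProj ((-1) ^ ℓ * ε) * S)
    (hT : HasAdjoint C (S * ρ.chiralProj ε) T) :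
    S * ρ.chiralProj ε + ((Δ₀ * Δ₁ : ℤ) : ℂ) • T = 0 ↔
      S * ρ.chiralProj ε = 0 ∨ IsAdmissibleDegree n ℓ (Δ₀ * Δ₁) := by
  have hTS : T = (((Δ₀ * Δ₁ : ℤ) : ℂ) ^ ℓ * (-1) ^ ℓ.choose 2) •
      (S * ρ.chiralProj ((-1) ^ (n + ℓ) * ε)) := by
    rw [hT.unique hC.separatingRight (hS.mul (hC.hasAdjoint_chiralProj ε)), mul_smul_comm, hSP,
      pow_add, ← mul_assoc, mul_left_comm]
    simp [← mul_pow]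
  rw [isAdmissibleDegree_iff hC.sign_mul_eq]
  rcases Nat.even_or_odd (n + ℓ) with hpar | hpar
  · have hcast : ((Δ₀ * Δ₁ : ℤ) : ℂ) * (((Δ₀ * Δ₁ : ℤ) : ℂ) ^ ℓ * (-1) ^ ℓ.choose 2) =
        (((Δ₀ * Δ₁) ^ (ℓ + 1) * (-1) ^ ℓ.choose 2 : ℤ) : ℂ) := by
      push_cast; ring
    rw [hTS, hpar.neg_one_pow, one_mul, smul_smul, hcast, and_iff_right hpar, or_comm]
    nth_rewrite 1 [← one_smul ℂ (S * _)]
    rw [← add_smul, smul_eq_zero, add_comm, ← eq_neg_iff_add_eq_zero]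
    norm_cast
  · rw [or_iff_left fun h => Nat.not_even_iff_odd.2 hpar h.1]
    refine ⟨fun h => ?_, fun h => ?_⟩
    · have hmul := congrArg (· * ρ.chiralProj ε) h
      simpa only [hTS, hpar.neg_one_pow, neg_one_mul, add_mul, smul_mul_assoc, mul_assoc, zero_mul,
        ρ.chiralProj_mul_self ht, ρ.chiralProj_neg_mul ht, mul_zero, smul_zero, add_zero]
        using hmul
    · rw [h] at hT ⊢
      rw [hT.unique hC.separatingRight (B' := 0) LinearMap.isAdjointPair_zero, smul_zero, add_zero]

end Adjoints

/-! ### The spin Lie algebra -/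

section SpinAlgebra

lemma lie_mul_eq_mul_add_sub {A : Type*} [Ring A] (x y z : A) :
    ⁅x * y, z⁆ = x * (y * z + z * y) - (x * z + z * x) * y := by
  rw [Ring.lie_def]
  noncomm_ring

section Algebra

variable {A κ : Type*} [Ring A] [Algebra ℝ A] [Fintype κ]

/-- The element `¼ ∑ w_{cb} γ^b γ^c`. For skew symmetric `w` and gamma matrices `γ^b` it belongs
to the spin Lie algebra. -/
def spinElement (G : κ → A) (w : κ → κ → ℝ) : A :=
  (4 : ℝ)⁻¹ • ∑ b, ∑ c, w c b • (G b * G c)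

lemma spinElement_lie [DecidableEq κ] {G : κ → A} {w : κ → κ → ℝ}
    (hw : ∀ b c, w b c = -w c b) {L : A} {a : κ}
    (hL : ∀ c, G c * L + L * G c = algebraMap ℝ A (if c = a then -2 else 0)) :
    ⁅spinElement G w, L⁆ = ∑ c, w c a • G c := by
  have hlie (b c : κ) : ⁅G b * G c, L⁆ =
      (if b = a then (2 : ℝ) else 0) • G c - (if c = a then (2 : ℝ) else 0) • G b := by
    rw [lie_mul_eq_mul_add_sub, hL, hL, ← Algebra.commutes, ← Algebra.smul_def, ← Algebra.smul_def]
    split_ifs <;> module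
  have hskew : ∑ b, w a b • (2 : ℝ) • G b = -∑ b, w b a • (2 : ℝ) • G b := by
    rw [← Finset.sum_neg_distrib]
    exact Finset.sum_congr rfl fun b _ => by rw [hw a b, neg_smul]
  have hsum : ∑ b, ∑ c, w c b • ⁅G b * G c, L⁆ =
      ∑ c, w c a • (2 : ℝ) • G c - ∑ b, w a b • (2 : ℝ) • G b := by
    simp only [hlie, smul_sub, Finset.sum_sub_distrib, ite_smul, zero_smul, smul_ite, smul_zero,
      Finset.sum_ite_eq', Finset.mem_univ, if_true]
    rw [Finset.sum_comm]
    simp only [Finset.sum_ite_eq', Finset.mem_univ, if_true]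
  calc ⁅spinElement G w, L⁆ = (4 : ℝ)⁻¹ • ∑ b, ∑ c, w c b • ⁅G b * G c, L⁆ := by
        simp only [spinElement, Ring.lie_def, smul_mul_assoc, mul_smul_comm, Finset.sum_mul,
          Finset.mul_sum, smul_sub, Finset.sum_sub_distrib]
    _ = (4 : ℝ)⁻¹ • ∑ c, (4 : ℝ) • w c a • G c := by
        rw [hsum, hskew, sub_neg_eq_add, ← Finset.sum_add_distrib]
        exact congrArg _ (Finset.sum_congr rfl fun c _ => by module)
    _ = ∑ c, w c a • G c := by
        rw [← Finset.smul_sum, inv_smul_smul₀ four_ne_zero]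

lemma spinElement_swap {G : κ → A} {w : κ → κ → ℝ} (hw : ∀ b c, w b c = -w c b) :
    (4 : ℝ)⁻¹ • ∑ b, ∑ c, w c b • (G c * G b) = -spinElement G w := by
  rw [spinElement, ← smul_neg, Finset.sum_comm, ← Finset.sum_neg_distrib]
  refine congrArg _ (Finset.sum_congr rfl fun b _ => ?_)
  rw [← Finset.sum_neg_distrib]
  exact Finset.sum_congr rfl fun c _ => by rw [hw b c, neg_smul]

end Algebra

variable {n t : ℕ} {ρ : SpinorRep n t}

lemma spinElement_gammaUp_lie_vec {w : Fin (2 * n) → Fin (2 * n) → ℝ}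
    (hw : ∀ b c, w b c = -w c b) (v : Fin (2 * n) → ℝ) :
    ⁅spinElement ρ.gammaUp w, ρ.vec v⁆ = ∑ a, v a • ∑ c, w c a • ρ.gammaUp c := by
  have hsingle (a : Fin (2 * n)) :
      ⁅spinElement ρ.gammaUp w, ρ.vec (Pi.single a 1)⁆ = ∑ c, w c a • ρ.gammaUp c := by
    refine spinElement_lie hw fun c => ?_
    rw [SpinorRep.gammaUp, smul_mul_assoc, mul_smul_comm, ← smul_add, ρ.vec_mul_vec_add,
      polar_cliffordForm_single, Algebra.smul_def, ← map_mul, mul_ite, mul_zero, mul_left_comm,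
      sgn_mul_self, mul_one]
  conv_lhs => rw [pi_eq_sum_univ' v, map_sum, Ring.lie_def, Finset.mul_sum, Finset.sum_mul,
    ← Finset.sum_sub_distrib]
  refine Finset.sum_congr rfl fun a _ => ?_
  rw [← hsingle, Ring.lie_def, smul_sub, map_smul, mul_smul_comm, smul_mul_assoc]

lemma IsChargeConjugation.hasAdjoint_spinElement {C : Spinor n →ₗ[ℂ] Spinor n →ₗ[ℂ] ℂ} {Δ₀ Δ₁ : ℤ}
    (hC : IsChargeConjugation ρ C Δ₀ Δ₁) {w : Fin (2 * n) → Fin (2 * n) → ℝ}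
    (hw : ∀ b c, w b c = -w c b) :
    HasAdjoint C (spinElement ρ.gammaUp w) (-spinElement ρ.gammaUp w) := by
  have hmul (b c : Fin (2 * n)) :
      HasAdjoint C (ρ.gammaUp b * ρ.gammaUp c) (ρ.gammaUp c * ρ.gammaUp b) := by
    have h := (hC.hasAdjoint_gammaUp b).mul (hC.hasAdjoint_gammaUp c)
    rwa [smul_mul_smul_comm, ← sq, hC.sign_mul_sq, one_smul] at h
  rw [← spinElement_swap hw]
  exact (HasAdjoint.sum fun b _ => HasAdjoint.sum fun c _ => (hmul b c).smul (w c b)).smul (4 : ℝ)⁻¹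

end SpinAlgebra

/-! ### Calculus on manifolds -/

section Calculus

variable {𝕜 : Type*} [NontriviallyNormedField 𝕜] {E H M : Type*} [NormedAddCommGroup E]
  [NormedSpace 𝕜 E] [TopologicalSpace H] {I : ModelWithCorners 𝕜 E H} [TopologicalSpace M]
  [ChartedSpace H M] {F : Type*} [NormedAddCommGroup F] [NormedSpace 𝕜 F] {x : M}

lemma mvfderiv_eq_of_hasMFDerivAt {u : M → F} {u' : E →L[𝕜] F}
    (h : HasMFDerivAt I 𝓘(𝕜, F) u x u') (Z : TangentSpace I x) : mvfderiv I u x Z = u' Z :=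
  congrArg (fun L : E →L[𝕜] F => L Z) h.mfderiv

lemma mvfderiv_congr {u v : M → F} (h : u =ᶠ[𝓝 x] v) : mvfderiv I u x = mvfderiv I v x :=
  h.mfderiv_eq (I := I) (I' := 𝓘(𝕜, F))

variable {G : Type*} [NormedAddCommGroup G] [NormedSpace 𝕜 G]

lemma mvfderiv_clm_comp (L : F →L[𝕜] G) {u : M → F} (hu : MDifferentiableAt I 𝓘(𝕜, F) u x)
    (Z : TangentSpace I x) : mvfderiv I (fun y => L (u y)) x Z = L (mvfderiv I u x Z) :=
  have hderiv := L.hasFDerivAt.comp_hasFDerivWithinAt _ hu.hasMFDerivAt.2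
  mvfderiv_eq_of_hasMFDerivAt (I := I) (u' := L ∘L (mfderiv I 𝓘(𝕜, F) u x : E →L[𝕜] F))
    ⟨L.continuous.continuousAt.comp hu.continuousAt, hderiv⟩ Z

lemma mvfderiv_bilinear {K : Type*} [NormedAddCommGroup K] [NormedSpace 𝕜 K]
    (B : F →L[𝕜] G →L[𝕜] K) {u : M → F} {v : M → G} (hu : MDifferentiableAt I 𝓘(𝕜, F) u x)
    (hv : MDifferentiableAt I 𝓘(𝕜, G) v x) (Z : TangentSpace I x) :
    mvfderiv I (fun y => B (u y) (v y)) x Z =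
      B (u x) (mvfderiv I v x Z) + B (mvfderiv I u x Z) (v x) := by
  have hcont : ContinuousAt (fun y => B (u y) (v y)) x :=
    (B.continuous.continuousAt.comp hu.continuousAt).clm_apply hv.continuousAt
  have hderiv := B.hasFDerivWithinAt_of_bilinear hu.hasMFDerivAt.2 hv.hasMFDerivAt.2
  refine (mvfderiv_eq_of_hasMFDerivAt (I := I) ⟨hcont, hderiv⟩ Z).trans ?_
  simp [writtenInExtChartAt]
  rfl

lemma covariantDerivative_sum_smul {V : M → Type*} [TopologicalSpace (TotalSpace F V)]
    [∀ x, AddCommGroup (V x)] [∀ x, Module 𝕜 (V x)] [∀ x, TopologicalSpace (V x)]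
    [∀ x, IsTopologicalAddGroup (V x)] [∀ x, ContinuousSMul 𝕜 (V x)] [FiberBundle F V]
    [VectorBundle 𝕜 F V] (D : CovariantDerivative I F V) {κ : Type*} {S : Finset κ}
    {f : κ → M → 𝕜} {e : κ → (x : M) → V x} (hf : ∀ k ∈ S, MDiffAt (f k) x)
    (he : ∀ k ∈ S, MDiffAt (T% (e k ·)) x) (Z : TangentSpace I x) :
    D (fun y => ∑ k ∈ S, f k y • e k y) x Z =
      ∑ k ∈ S, (f k x • D (e k) x Z + mvfderiv I (f k) x Z • e k x) := by
  classical
  induction S using Finset.induction_on with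
  | empty =>
    simp only [Finset.sum_empty]
    exact congrArg (fun T => T x Z) D.zero
  | insert k S hk ih =>
    rw [Finset.forall_mem_insert] at hf he
    have hsplit : (fun y => ∑ j ∈ insert k S, f j y • e j y) =
        f k • e k + fun y => ∑ j ∈ S, f j y • e j y :=
      funext fun y => Finset.sum_insert hk
    have hsum : MDiffAt (T% (fun y => ∑ j ∈ S, f j y • e j y)) x :=
      .sum_section fun j hj => (hf.2 j hj).smul_section (he.2 j hj)
    rw [hsplit, D.isCovariantDerivativeOnUniv.add (σ := f k • e k) (hf.1.smul_section he.1) hsum,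
      D.isCovariantDerivativeOnUniv.leibniz he.1 hf.1, Finset.sum_insert hk, ← ih hf.2 he.2]
    rfl

end Calculus

section SmoothSections

lemma exists_contMDiff_section_eq {E H M : Type*} [NormedAddCommGroup E] [NormedSpace ℝ E]
    [FiniteDimensional ℝ E] [TopologicalSpace H] {I : ModelWithCorners ℝ E H}
    [TopologicalSpace M] [ChartedSpace H M] [IsManifold I ∞ M] [T2Space M]
    (F : Type*) [NormedAddCommGroup F] [NormedSpace ℝ F]
    {V : M → Type*} [TopologicalSpace (TotalSpace F V)] [∀ x, AddCommGroup (V x)]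
    [∀ x, Module ℝ (V x)] [∀ x, TopologicalSpace (V x)] [FiberBundle F V] [VectorBundle ℝ F V]
    [ContMDiffVectorBundle ∞ F V I] {x : M} (v : V x) :
    ∃ σ : (y : M) → V y, ContMDiff I (I.prod 𝓘(ℝ, F)) ∞
      (fun y => (⟨y, σ y⟩ : TotalSpace F V)) ∧ σ x = v := by
  obtain ⟨u, hu, hsm⟩ := FiberBundle.exists_contMDiffOn_extend (k := ∞) I F v
  obtain ⟨o, hou, ho, hxo⟩ := mem_nhds_iff.1 hu
  obtain ⟨f, -, hf⟩ := (SmoothBumpFunction.nhds_basis_tsupport (I := I) x).mem_iff.1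
    (ho.mem_nhds hxo)
  refine ⟨fun y => f y • FiberBundle.extend F v y,
    f.contMDiff.contMDiffOn.smul_section_of_tsupport ho hf (hsm.mono hou), ?_⟩
  simp

end SmoothSections

/-! ### The spin connection of a metric connection -/

section Manifold

variable {n : ℕ} {M : Type*} [TopologicalSpace M] [ChartedSpace (E n) M]
  [IsManifold (mdl n) ∞ M] {g : PseudoRiemannianMetric n M} {nab : TangentConnection n M}

namespace PseudoRiemannianMetric

variable {X Y : (x : M) → TangentSpace (mdl n) x} {x : M}

lemma mdifferentiableAt (g : PseudoRiemannianMetric n M)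
    (hX : MDifferentiableAt (mdl n) (mdl n).tangent
      (fun y => (⟨y, X y⟩ : TangentBundle (mdl n) M)) x)
    (hY : MDifferentiableAt (mdl n) (mdl n).tangent
      (fun y => (⟨y, Y y⟩ : TangentBundle (mdl n) M)) x) :
    MDifferentiableAt (mdl n) 𝓘(ℝ, ℝ) (fun y => g.val y (X y) (Y y)) x :=
  (mdifferentiableAt_section (F := ℝ) (E := Bundle.Trivial M ℝ) _ _).1
    (MDifferentiableAt.clm_bundle_apply₂ (F₁ := E n) (F₂ := E n)
      ((g.contMDiff x).mdifferentiableAt (by simp)) hX hY)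

lemma contMDiffAt (g : PseudoRiemannianMetric n M)
    (hX : ContMDiffAt (mdl n) (mdl n).tangent ∞
      (fun y => (⟨y, X y⟩ : TangentBundle (mdl n) M)) x)
    (hY : ContMDiffAt (mdl n) (mdl n).tangent ∞
      (fun y => (⟨y, Y y⟩ : TangentBundle (mdl n) M)) x) :
    ContMDiffAt (mdl n) 𝓘(ℝ, ℝ) ∞ (fun y => g.val y (X y) (Y y)) x :=
  (contMDiffAt_section (F := ℝ) (E := Bundle.Trivial M ℝ) _).1
    (ContMDiffAt.clm_bundle_apply₂ (F₁ := E n) (F₂ := E n) (g.contMDiff x) hX hY)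

end PseudoRiemannianMetric

/-- The connection `nab` on `TM` is metric, i.e. `g` is parallel for it. -/
def IsMetricConnection (g : PseudoRiemannianMetric n M) (nab : TangentConnection n M) : Prop :=
  ∀ (Y Z : (x : M) → TangentSpace (mdl n) x) (x : M),
    MDifferentiableAt (mdl n) (mdl n).tangent
      (fun y => (⟨y, Y y⟩ : TangentBundle (mdl n) M)) x →
    MDifferentiableAt (mdl n) (mdl n).tangent
      (fun y => (⟨y, Z y⟩ : TangentBundle (mdl n) M)) x →
    ∀ v : TangentSpace (mdl n) x,
    mvfderiv (mdl n) (fun y => g.val y (Y y) (Z y)) x v =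
      g.val x (nab Y x v) (Z x) + g.val x (Y x) (nab Z x v)

namespace SpinStructure

variable {ι : Type*} {t : ℕ} (s : SpinStructure ι t g) {i : ι} {x : M}

section Frame

/-- The components of a tangent vector in the frame with index `i`. For `i = s.indexAt x` this is
`s.comp x`, by definition. -/
def compAt (i : ι) (x : M) : TangentSpace (mdl n) x →ₗ[ℝ] (Fin (2 * n) → ℝ) :=
  LinearMap.pi fun a => sgn n t a • (g.val x (s.frame i a x)).toLinearMap

lemma compAt_apply (i : ι) (x : M) (v : TangentSpace (mdl n) x) (a : Fin (2 * n)) :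
    s.compAt i x v a = sgn n t a * g.val x (s.frame i a x) v := rfl

lemma compAt_sum (hx : x ∈ s.baseSet i) (c : Fin (2 * n) → ℝ) :
    s.compAt i x (∑ a, c a • s.frame i a x) = c := by
  funext b
  rw [compAt_apply, map_sum]
  simp only [map_smul, smul_eq_mul, s.orthonormal i x hx, mul_ite, mul_zero, Finset.sum_ite_eq,
    Finset.mem_univ, if_true]
  rw [mul_left_comm, sgn_mul_self, mul_one]

lemma compAt_frame (hx : x ∈ s.baseSet i) (a : Fin (2 * n)) :
    s.compAt i x (s.frame i a x) = Pi.single a 1 := by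
  simpa [Pi.single_apply] using s.compAt_sum hx (Pi.single a 1)

lemma sum_compAt (hx : x ∈ s.baseSet i) (v : TangentSpace (mdl n) x) :
    ∑ a, s.compAt i x v a • s.frame i a x = v := by
  have hsurj : Function.Surjective (s.compAt i x) := fun c => ⟨_, s.compAt_sum hx c⟩
  have hdim : Module.finrank ℝ (E n) = Module.finrank ℝ (Fin (2 * n) → ℝ) := by simp
  have : FiniteDimensional ℝ (TangentSpace (mdl n) x) := inferInstanceAs (FiniteDimensional ℝ (E n))
  exact (LinearMap.injective_iff_surjective_of_finrank_eq_finrank hdim).2 hsurj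
    (s.compAt_sum hx _)

lemma baseSet_mem_nhds (hx : x ∈ s.baseSet i) : s.baseSet i ∈ 𝓝 x :=
  (s.isOpen_baseSet i).mem_nhds hx

lemma contMDiffAt_frame (hx : x ∈ s.baseSet i) (a : Fin (2 * n)) :
    ContMDiffAt (mdl n) (mdl n).tangent ∞
      (fun y => (⟨y, s.frame i a y⟩ : TangentBundle (mdl n) M)) x :=
  (s.contMDiffOn_frame i a).contMDiffAt (s.baseSet_mem_nhds hx)

lemma mdifferentiableAt_frame (hx : x ∈ s.baseSet i) (a : Fin (2 * n)) :
    MDifferentiableAt (mdl n) (mdl n).tangent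
      (fun y => (⟨y, s.frame i a y⟩ : TangentBundle (mdl n) M)) x :=
  (s.contMDiffAt_frame hx a).mdifferentiableAt (by simp)

lemma mdifferentiableAt_compAt (hx : x ∈ s.baseSet i) {X : (x : M) → TangentSpace (mdl n) x}
    (hX : MDifferentiableAt (mdl n) (mdl n).tangent
      (fun y => (⟨y, X y⟩ : TangentBundle (mdl n) M)) x) :
    MDifferentiableAt (mdl n) 𝓘(ℝ, Fin (2 * n) → ℝ) (fun y => s.compAt i y (X y)) x := by
  have hcoord (a : Fin (2 * n)) :
      MDifferentiableAt (mdl n) 𝓘(ℝ, ℝ) (fun y => s.compAt i y (X y) a) x :=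
    (mdifferentiableAt_const (c := sgn n t a)).smul
      (g.mdifferentiableAt (s.mdifferentiableAt_frame hx a) hX)
  exact (mdifferentiableAt_iff _ _).2 ⟨continuousAt_pi.2 fun a => (hcoord a).continuousAt,
    differentiableWithinAt_pi.2 fun a => ((mdifferentiableAt_iff _ _).1 (hcoord a)).2⟩

lemma covariantDerivative_eq_sum_frame (nab : TangentConnection n M) (hx : x ∈ s.baseSet i)
    {X : (x : M) → TangentSpace (mdl n) x}
    (hX : MDifferentiableAt (mdl n) (mdl n).tangent
      (fun y => (⟨y, X y⟩ : TangentBundle (mdl n) M)) x) (Z : TangentSpace (mdl n) x) :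
    nab X x Z = ∑ a, (s.compAt i x (X x) a • nab (s.frame i a) x Z +
      mvfderiv (mdl n) (fun y => s.compAt i y (X y)) x Z a • s.frame i a x) := by
  let coord (a : Fin (2 * n)) := ContinuousLinearMap.proj (R := ℝ) (φ := fun _ => ℝ) a
  have hcomp := s.mdifferentiableAt_compAt hx hX
  have hcoord (a : Fin (2 * n)) :
      MDifferentiableAt (mdl n) 𝓘(ℝ, ℝ) (fun y => s.compAt i y (X y) a) x :=
    (coord a).mdifferentiableAt.comp x hcomp
  have hframe := s.mdifferentiableAt_frame hx
  have hexpand : nab X x = nab (fun y => ∑ a, s.compAt i y (X y) a • s.frame i a y) x := by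
    refine nab.isCovariantDerivativeOnUniv.congr_of_eventuallyEq hX
      (.sum_section fun a _ => (hcoord a).smul_section (hframe a)) Filter.univ_mem ?_
    filter_upwards [s.baseSet_mem_nhds hx] with y hy using (s.sum_compAt hy (X y)).symm
  have hderiv (a : Fin (2 * n)) : mvfderiv (mdl n) (fun y => s.compAt i y (X y) a) x Z =
      mvfderiv (mdl n) (fun y => s.compAt i y (X y)) x Z a :=
    mvfderiv_clm_comp (coord a) hcomp Z
  rw [hexpand, covariantDerivative_sum_smul nab (fun a _ => hcoord a) fun a _ => hframe a]
  simp only [hderiv]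

/-- The coefficients `g(e_c, ∇_Z e_b)` of a connection in the frame with index `i`. -/
def connCoeff (nab : TangentConnection n M) (i : ι) (x : M) (Z : TangentSpace (mdl n) x)
    (c b : Fin (2 * n)) : ℝ :=
  g.val x (s.frame i c x) (nab (s.frame i b) x Z)

lemma connCoeff_skew (hnab : IsMetricConnection g nab) (hx : x ∈ s.baseSet i)
    (Z : TangentSpace (mdl n) x) (b c : Fin (2 * n)) :
    s.connCoeff nab i x Z b c = -s.connCoeff nab i x Z c b := by
  have hmetric := hnab (s.frame i b) (s.frame i c) x (s.mdifferentiableAt_frame hx b)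
    (s.mdifferentiableAt_frame hx c) Z
  have hconst : (fun y => g.val y (s.frame i b y) (s.frame i c y)) =ᶠ[𝓝 x]
      fun _ => if b = c then sgn n t b else 0 := by
    filter_upwards [s.baseSet_mem_nhds hx] with y hy using s.orthonormal i y hy b c
  rw [mvfderiv_congr hconst, mvfderiv_const, g.symm x (nab (s.frame i b) x Z)] at hmetric
  exact eq_neg_of_add_eq_zero_right hmetric.symm

end Frame

variable (ρ : SpinorRep n t)

lemma gamma_covariantDerivative_frame (nab : TangentConnection n M) (x : M)
    (Z : TangentSpace (mdl n) x) (b : Fin (2 * n)) :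
    s.gamma ρ x (nab (s.frame (s.indexAt x) b) x Z) =
      ∑ c, s.connCoeff nab (s.indexAt x) x Z c b • ρ.gammaUp c := by
  change ρ.vec (s.compAt (s.indexAt x) x _) = _
  rw [ρ.vec_eq_sum]
  refine Finset.sum_congr rfl fun c _ => ?_
  rw [compAt_apply, ← mul_assoc, sgn_mul_self, one_mul, connCoeff]

lemma spinForm_eq_spinElement (nab : TangentConnection n M) (x : M) (Z : TangentSpace (mdl n) x) :
    s.spinForm ρ nab x Z = spinElement ρ.gammaUp (s.connCoeff nab (s.indexAt x) x Z) := by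
  simp only [spinForm, LinearMap.smul_apply, LinearMap.sum_apply, LinearMap.comp_apply,
    LinearMap.mulLeft_apply, ContinuousLinearMap.coe_coe, gamma_covariantDerivative_frame,
    Finset.mul_sum, mul_smul_comm, spinElement]

lemma spinForm_lie_vec (hnab : IsMetricConnection g nab) (x : M) (Z : TangentSpace (mdl n) x)
    (v : Fin (2 * n) → ℝ) :
    ⁅s.spinForm ρ nab x Z, ρ.vec v⁆ =
      s.gamma ρ x (∑ a, v a • nab (s.frame (s.indexAt x) a) x Z) := by
  rw [spinForm_eq_spinElement,
    spinElement_gammaUp_lie_vec (s.connCoeff_skew hnab (s.mem_baseSet_at x) Z)]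
  simp only [map_sum, map_smul, gamma_covariantDerivative_frame]

variable {ρ} in
lemma hasAdjoint_spinForm {C : Spinor n →ₗ[ℂ] Spinor n →ₗ[ℂ] ℂ} {Δ₀ Δ₁ : ℤ}
    (hC : IsChargeConjugation ρ C Δ₀ Δ₁) (hnab : IsMetricConnection g nab) (x : M)
    (Z : TangentSpace (mdl n) x) :
    HasAdjoint C (s.spinForm ρ nab x Z) (-s.spinForm ρ nab x Z) := by
  rw [spinForm_eq_spinElement]
  exact hC.hasAdjoint_spinElement (s.connCoeff_skew hnab (s.mem_baseSet_at x) Z)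

lemma gamma_covariantDerivative (hnab : IsMetricConnection g nab)
    {X : (x : M) → TangentSpace (mdl n) x}
    (hX : MDifferentiableAt (mdl n) (mdl n).tangent
      (fun y => (⟨y, X y⟩ : TangentBundle (mdl n) M)) x) (Z : TangentSpace (mdl n) x) :
    s.gamma ρ x (nab X x Z) = ⁅s.spinForm ρ nab x Z, s.gamma ρ x (X x)⁆ +
      ρ.vec (mvfderiv (mdl n) (fun y => s.compAt (s.indexAt x) y (X y)) x Z) := by
  have hx := s.mem_baseSet_at x
  rw [s.covariantDerivative_eq_sum_frame nab hx hX, Finset.sum_add_distrib, map_add]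
  exact congrArg₂ (· + ·) (s.spinForm_lie_vec ρ hnab x Z _).symm
    (congrArg ρ.vec (s.compAt_sum hx _))

lemma localRep_self (ψ : (x : M) → s.Fib ρ x) (x : M) : s.localRep ρ ψ x x = ψ x :=
  (s.core ρ).coordChange_self _ x ((s.core ρ).mem_baseSet_at x) (ψ x)

lemma localRep_cliff (X : (x : M) → TangentSpace (mdl n) x) (ξ : (x : M) → s.Fib ρ x) {y : M}
    (hy : y ∈ s.baseSet (s.indexAt x)) :
    s.localRep ρ (fun y => s.cliff ρ (X y) (ξ y)) x y =
      ρ.vec (s.compAt (s.indexAt x) y (X y)) (s.localRep ρ ξ x y) := by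
  have hcovers := s.trans_covers (s.indexAt y) (s.indexAt x) y ⟨s.mem_baseSet_at y, hy⟩
    (s.compAt (s.indexAt y) y (X y)) (s.compAt (s.indexAt x) y (X y))
    ((s.sum_compAt (s.mem_baseSet_at y) (X y)).trans (s.sum_compAt hy (X y)).symm)
  have hρ := congrArg ρ hcovers
  rw [map_mul, map_mul] at hρ
  exact congrArg (fun T : Module.End ℂ (Spinor n) => T (ξ y)) hρ

lemma leviCivita_apply (nab : TangentConnection n M) (ψ : (x : M) → s.Fib ρ x) (x : M)
    (Z : TangentSpace (mdl n) x) :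
    s.leviCivita ρ nab ψ x Z =
      mvfderiv (mdl n) (s.localRep ρ ψ x) x Z + s.spinForm ρ nab x Z (ψ x) := rfl

/-- The Clifford product `(v, φ) ↦ v φ`, as a continuous bilinear map. -/
def vecBilin : (Fin (2 * n) → ℝ) →L[ℝ] Spinor n →L[ℝ] Spinor n :=
  LinearMap.toContinuousBilinearMap
    (LinearMap.mk₂ ℝ (fun v φ => ρ.vec v φ) (fun v w φ => by simp) (fun c v φ => by simp)
      (fun v φ ψ => by simp) (fun c v φ => by simp))

/-- A complex bilinear form on the spinors, as a continuous real bilinear map. -/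
def formBilin (C : Spinor n →ₗ[ℂ] Spinor n →ₗ[ℂ] ℂ) : Spinor n →L[ℝ] Spinor n →L[ℝ] ℂ :=
  LinearMap.toContinuousBilinearMap
    (LinearMap.mk₂ ℝ (fun φ ψ => C φ ψ) (fun v w φ => by simp) (fun c v φ => by simp)
      (fun v φ ψ => by simp) (fun c v φ => by simp))

lemma leviCivita_cliff (hnab : IsMetricConnection g nab)
    {X : (x : M) → TangentSpace (mdl n) x} {ξ : (x : M) → s.Fib ρ x}
    (hX : MDifferentiableAt (mdl n) (mdl n).tangent
      (fun y => (⟨y, X y⟩ : TangentBundle (mdl n) M)) x)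
    (hξ : MDifferentiableAt (mdl n) ((mdl n).prod 𝓘(ℝ, Spinor n))
      (fun y => (⟨y, ξ y⟩ : TotalSpace (Spinor n) (s.Fib ρ))) x)
    (Z : TangentSpace (mdl n) x) :
    s.leviCivita ρ nab (fun y => s.cliff ρ (X y) (ξ y)) x Z =
      s.cliff ρ (nab X x Z) (ξ x) + s.cliff ρ (X x) (s.leviCivita ρ nab ξ x Z) := by
  have hx := s.mem_baseSet_at x
  have hloc : s.localRep ρ (fun y => s.cliff ρ (X y) (ξ y)) x =ᶠ[𝓝 x]
      fun y => vecBilin ρ (s.compAt (s.indexAt x) y (X y)) (s.localRep ρ ξ x y) := by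
    filter_upwards [s.baseSet_mem_nhds hx] with y hy using s.localRep_cliff ρ X ξ hy
  rw [leviCivita_apply, leviCivita_apply, mvfderiv_congr hloc, mvfderiv_bilinear _
    (s.mdifferentiableAt_compAt hx hX) (s.mdifferentiableAt_localRep ρ hξ), localRep_self]
  let φ : Spinor n := ξ x
  let dφ : Spinor n := mvfderiv (mdl n) (s.localRep ρ ξ x) x Z
  let Ω : Module.End ℂ (Spinor n) := s.spinForm ρ nab x Z
  let G : Module.End ℂ (Spinor n) := s.gamma ρ x (X x)
  let W := ρ.vec (mvfderiv (mdl n) (fun y => s.compAt (s.indexAt x) y (X y)) x Z)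
  change G dφ + W φ + Ω (G φ) = s.gamma ρ x (nab X x Z) φ + G (dφ + Ω φ)
  have hγ : s.gamma ρ x (nab X x Z) φ = Ω (G φ) - G (Ω φ) + W φ :=
    LinearMap.congr_fun (s.gamma_covariantDerivative ρ hnab hX Z) φ
  rw [hγ, map_add]
  abel

variable {ρ} in
lemma leviCivita_chargeConjugation {C : Spinor n →ₗ[ℂ] Spinor n →ₗ[ℂ] ℂ} {Δ₀ Δ₁ : ℤ}
    (hC : IsChargeConjugation ρ C Δ₀ Δ₁) (hnab : IsMetricConnection g nab)
    {φ ψ : (x : M) → s.Fib ρ x}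
    (hφ : MDifferentiableAt (mdl n) ((mdl n).prod 𝓘(ℝ, Spinor n))
      (fun y => (⟨y, φ y⟩ : TotalSpace (Spinor n) (s.Fib ρ))) x)
    (hψ : MDifferentiableAt (mdl n) ((mdl n).prod 𝓘(ℝ, Spinor n))
      (fun y => (⟨y, ψ y⟩ : TotalSpace (Spinor n) (s.Fib ρ))) x)
    (Z : TangentSpace (mdl n) x) :
    mvfderiv (mdl n) (fun y => C (φ y) (ψ y)) x Z =
      C (s.leviCivita ρ nab φ x Z) (ψ x) + C (φ x) (s.leviCivita ρ nab ψ x Z) := by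
  have hloc : (fun y => C (φ y) (ψ y)) =ᶠ[𝓝 x]
      fun y => formBilin C (s.localRep ρ φ x y) (s.localRep ρ ψ x y) := by
    filter_upwards [s.baseSet_mem_nhds (s.mem_baseSet_at x)] with y hy
    exact (hC.spin_invariant _ (s.trans_mem _ _ y ⟨s.mem_baseSet_at y, hy⟩) _ _).symm
  rw [mvfderiv_congr hloc, mvfderiv_bilinear _ (s.mdifferentiableAt_localRep ρ hφ)
    (s.mdifferentiableAt_localRep ρ hψ), leviCivita_apply, leviCivita_apply, localRep_self,
    localRep_self]
  let φ₀ : Spinor n := φ x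
  let ψ₀ : Spinor n := ψ x
  let dφ : Spinor n := mvfderiv (mdl n) (s.localRep ρ φ x) x Z
  let dψ : Spinor n := mvfderiv (mdl n) (s.localRep ρ ψ x) x Z
  let Ω : Module.End ℂ (Spinor n) := s.spinForm ρ nab x Z
  change C φ₀ dψ + C dφ ψ₀ = C (dφ + Ω φ₀) ψ₀ + C φ₀ (dψ + Ω ψ₀)
  have hskew : C (Ω φ₀) ψ₀ = C φ₀ ((-Ω) ψ₀) := s.hasAdjoint_spinForm hC hnab x Z φ₀ ψ₀
  rw [map_add, LinearMap.add_apply, hskew, map_add, LinearMap.neg_apply, map_neg]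
  ring

end SpinStructure

end Manifold

/-! ### Admissibility -/

lemma mul_mul_add_swap_eq_smul {R A : Type*} [CommSemiring R] [Ring A] [Algebra R A]
    {G K : A} {r : R} (h : G * K + K * G = algebraMap R A r) (T U : A) :
    T * G * K + K * (G * U) + (T * K * G + G * (K * U)) = r • (T + U) := by
  rw [Algebra.smul_def, mul_add, Algebra.commutes r T, ← h]
  noncomm_ring

section Manifold

variable {n : ℕ} {M : Type*} [TopologicalSpace M] [ChartedSpace (E n) M]
  [IsManifold (mdl n) ∞ M] {g : PseudoRiemannianMetric n M} {nab : TangentConnection n M}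

namespace SpinStructure

variable {ι : Type*} {t : ℕ} {s : SpinStructure ι t g} {ρ : SpinorRep n t}
  {C : Spinor n →ₗ[ℂ] Spinor n →ₗ[ℂ] ℂ} {Δ₀ Δ₁ : ℤ}

lemma addForm_apply (D : s.SpinorConnection ρ)
    (B : (x : M) → TangentSpace (mdl n) x →ₗ[ℝ] Module.End ℂ (Spinor n))
    (ψ : (x : M) → s.Fib ρ x) (x : M) (Z : TangentSpace (mdl n) x) :
    addForm D B ψ x Z = D ψ x Z + s.applyFib ρ (B x) (ψ x) Z := rfl

section

variable {A A' : (x : M) → TangentSpace (mdl n) x →ₗ[ℝ] Module.End ℂ (Spinor n)}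

lemma isConjugate_addForm (hC : IsChargeConjugation ρ C Δ₀ Δ₁) (hnab : IsMetricConnection g nab)
    (hA : ∀ x Z, HasAdjoint C (A x Z) (A' x Z)) :
    IsConjugate C (addForm (s.leviCivita ρ nab) A)
      (addForm (s.leviCivita ρ nab) fun x => -A' x) := by
  intro φ ψ hφ hψ x Z
  rw [s.leviCivita_chargeConjugation hC hnab ((hφ x).mdifferentiableAt (by simp))
    ((hψ x).mdifferentiableAt (by simp)), addForm_apply, addForm_apply]
  let φ₀ : Spinor n := φ x
  let ψ₀ : Spinor n := ψ x
  let dφ : Spinor n := s.leviCivita ρ nab φ x Z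
  let dψ : Spinor n := s.leviCivita ρ nab ψ x Z
  have hadj : C (A x Z φ₀) ψ₀ = C φ₀ (A' x Z ψ₀) := hA x Z φ₀ ψ₀
  change C dφ ψ₀ + C φ₀ dψ = C (dφ + A x Z φ₀) ψ₀ + C φ₀ (dψ + (-A' x Z) ψ₀)
  rw [map_add, LinearMap.add_apply, hadj, map_add, LinearMap.neg_apply, map_neg]
  ring

lemma IsConjugate.eq_of_isConjugate [T2Space M] (hC : IsChargeConjugation ρ C Δ₀ Δ₁)
    {D D' D'' : s.SpinorConnection ρ} (h' : IsConjugate C D D') (h'' : IsConjugate C D D'')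
    {ψ : (x : M) → s.Fib ρ x} (hψ : s.IsSmoothSection ρ ψ) (x : M)
    (Z : TangentSpace (mdl n) x) : D' ψ x Z = D'' ψ x Z := by
  let a : Spinor n := D' ψ x Z
  let b : Spinor n := D'' ψ x Z
  have hpair (φ₀ : Spinor n) : C φ₀ a = C φ₀ b := by
    obtain ⟨φ, hφ, rfl⟩ := exists_contMDiff_section_eq (I := mdl n) (Spinor n) (V := s.Fib ρ)
      (x := x) φ₀
    exact add_left_cancel ((h' φ ψ hφ hψ x Z).symm.trans (h'' φ ψ hφ hψ x Z))
  exact sub_eq_zero.1 (hC.separatingRight (a - b) fun φ₀ => by rw [map_sub, hpair, sub_self])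

lemma hatGamma_addForm (hnab : IsMetricConnection g nab)
    {Z X : (x : M) → TangentSpace (mdl n) x} {ξ : (x : M) → s.Fib ρ x} (hX : IsSmoothVF X)
    (hξ : s.IsSmoothSection ρ ξ) (x : M) :
    hatGamma nab (addForm (s.leviCivita ρ nab) A)
        (addForm (s.leviCivita ρ nab) fun x => -A' x) Z X ξ x =
      (A x (Z x) * s.gamma ρ x (X x) + s.gamma ρ x (X x) * A' x (Z x) :
        Module.End ℂ (Spinor n)) (ξ x) := by
  rw [hatGamma, addForm_apply, addForm_apply, s.leviCivita_cliff ρ hnab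
    ((hX x).mdifferentiableAt (by simp)) ((hξ x).mdifferentiableAt (by simp))]
  let ξ₀ : Spinor n := ξ x
  let dξ : Spinor n := s.leviCivita ρ nab ξ x (Z x)
  let G := s.gamma ρ x (X x)
  let N := s.gamma ρ x (nab X x (Z x))
  change (N ξ₀ + G dξ + A x (Z x) (G ξ₀)) - N ξ₀ - G (dξ + (-A' x (Z x)) ξ₀) =
    A x (Z x) (G ξ₀) + G (A' x (Z x) ξ₀)
  rw [map_add, LinearMap.neg_apply, map_neg]
  abel

lemma isAdmissible_addForm_iff [T2Space M] (hC : IsChargeConjugation ρ C Δ₀ Δ₁)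
    (hnab : IsMetricConnection g nab) (hA : ∀ x Z, HasAdjoint C (A x Z) (A' x Z)) :
    IsAdmissible nab C (addForm (s.leviCivita ρ nab) A) ↔
      ∀ (x : M) (Z X : TangentSpace (mdl n) x),
        A x Z * s.gamma ρ x X + s.gamma ρ x X * A' x Z =
          -(A x X * s.gamma ρ x Z + s.gamma ρ x Z * A' x X) := by
  constructor
  · rintro ⟨D', hD', hskew⟩ x Z₀ X₀
    refine LinearMap.ext fun ξ₀ => ?_
    obtain ⟨Z, hZ, rfl⟩ := exists_contMDiff_section_eq (I := mdl n) (E n)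
      (V := fun x : M => TangentSpace (mdl n) x) (x := x) Z₀
    obtain ⟨X, hX, rfl⟩ := exists_contMDiff_section_eq (I := mdl n) (E n)
      (V := fun x : M => TangentSpace (mdl n) x) (x := x) X₀
    obtain ⟨ξ, hξ, rfl⟩ := exists_contMDiff_section_eq (I := mdl n) (Spinor n) (V := s.Fib ρ)
      (x := x) ξ₀
    have hD (Z X : (x : M) → TangentSpace (mdl n) x) :
        hatGamma nab (addForm (s.leviCivita ρ nab) A) D' Z X ξ x =
        hatGamma nab (addForm (s.leviCivita ρ nab) A)
          (addForm (s.leviCivita ρ nab) fun x => -A' x) Z X ξ x := by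
      rw [hatGamma, hatGamma,
        hD'.eq_of_isConjugate hC (isConjugate_addForm hC hnab hA) hξ x (Z x)]
    have hZX := hskew Z X ξ hZ hX hξ x
    rw [hD, hD, hatGamma_addForm hnab hX hξ, hatGamma_addForm hnab hZ hξ] at hZX
    exact hZX
  · intro hskew
    refine ⟨_, isConjugate_addForm hC hnab hA, fun Z X ξ hZ hX hξ x => ?_⟩
    rw [hatGamma_addForm hnab hX hξ, hatGamma_addForm hnab hZ hξ, hskew]
    rfl

end

/-- The `End(S)`-valued one-form `X ↦ T γ(X)`, for a field `T` of endomorphisms of the spinor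
bundle. -/
def mulGamma (s : SpinStructure ι t g) (ρ : SpinorRep n t) (T : M → Module.End ℂ (Spinor n))
    (x : M) : TangentSpace (mdl n) x →ₗ[ℝ] Module.End ℂ (Spinor n) :=
  LinearMap.mulLeft ℝ (T x) ∘ₗ s.gamma ρ x

lemma isAdmissible_addForm_mulGamma_iff [T2Space M] [NeZero n]
    (hC : IsChargeConjugation ρ C Δ₀ Δ₁) (hnab : IsMetricConnection g nab)
    {T T' : M → Module.End ℂ (Spinor n)} (hT : ∀ x, HasAdjoint C (T x) (T' x)) :
    IsAdmissible nab C (addForm (s.leviCivita ρ nab) (s.mulGamma ρ T)) ↔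
      ∀ x, T x + ((Δ₀ * Δ₁ : ℤ) : ℂ) • T' x = 0 := by
  let d : ℂ := ((Δ₀ * Δ₁ : ℤ) : ℂ)
  let A' (x : M) : TangentSpace (mdl n) x →ₗ[ℝ] Module.End ℂ (Spinor n) :=
    LinearMap.mulRight ℝ (d • T' x) ∘ₗ s.gamma ρ x
  have hA (x : M) (Z : TangentSpace (mdl n) x) :
      HasAdjoint C (s.mulGamma ρ T x Z) (A' x Z) := by
    have hmul := (hT x).mul (hC.hasAdjoint_vec (s.comp x Z))
    rw [smul_mul_assoc, ← mul_smul_comm] at hmul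
    exact hmul
  -- The symmetrisation of `(D̂_Z γ)(X)` is `-2 g(Z, X) (T + Δ₀ Δ₁ T')`.
  have hsymm (x : M) (Z X : TangentSpace (mdl n) x) :
      s.mulGamma ρ T x Z * s.gamma ρ x X + s.gamma ρ x X * A' x Z +
          (s.mulGamma ρ T x X * s.gamma ρ x Z + s.gamma ρ x Z * A' x X) =
        QuadraticMap.polar (cliffordForm n t) (s.comp x Z) (s.comp x X) •
          (T x + d • T' x) :=
    mul_mul_add_swap_eq_smul (ρ.vec_mul_vec_add (s.comp x Z) (s.comp x X)) (T x) (d • T' x)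
  rw [isAdmissible_addForm_iff hC hnab hA]
  refine forall_congr' fun x => ⟨fun h => ?_, fun h Z X => ?_⟩
  · let X := s.frame (s.indexAt x) 0 x
    have hX : s.comp x X = Pi.single 0 1 := s.compAt_frame (s.mem_baseSet_at x) 0
    have hXX := (eq_neg_iff_add_eq_zero.1 (h X X)).symm.trans (hsymm x X X)
    rw [hX, polar_cliffordForm_single, if_pos rfl] at hXX
    exact (smul_eq_zero.1 hXX.symm).resolve_left
      (mul_ne_zero (by norm_num) (left_ne_zero_of_mul_eq_one (sgn_mul_self 0)))
  · rw [eq_neg_iff_add_eq_zero, hsymm, h, smul_zero]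

/-! ### Forms -/

variable {ℓ : ℕ}

lemma formGamma_eq {x : M} (F : TangentSpace (mdl n) x [⋀^Fin ℓ]→ₗ[ℝ] ℂ) :
    s.formGamma ρ x F =
      ∑ a : Fin ℓ → Fin (2 * n), F (fun k => s.frame (s.indexAt x) (a k) x) • ρ.gammaProd a :=
  ρ.sum_smul_gammaAlt fun a σ => by
    rw [← zsmul_eq_mul, ← Units.smul_def]
    exact F.map_perm (fun k => s.frame (s.indexAt x) (a k) x) σ

variable (s) in
lemma hasAdjoint_formGamma (hC : IsChargeConjugation ρ C Δ₀ Δ₁) {x : M}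
    (F : TangentSpace (mdl n) x [⋀^Fin ℓ]→ₗ[ℝ] ℂ) :
    HasAdjoint C (s.formGamma ρ x F)
      ((((Δ₀ * Δ₁ : ℤ) : ℂ) ^ ℓ * (-1) ^ ℓ.choose 2) • s.formGamma ρ x F) := by
  rw [formGamma_eq]
  exact hC.hasAdjoint_sum_gammaProd fun a ha => F.map_eq_zero_of_not_injective _ fun h =>
    ha fun i j hij => h (by simp only [hij])

lemma formGamma_mul_chiralProj {x : M} (F : TangentSpace (mdl n) x [⋀^Fin ℓ]→ₗ[ℝ] ℂ) (ε : ℤˣ) :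
    s.formGamma ρ x F * ρ.chiralProj ε = ρ.chiralProj ((-1) ^ ℓ * ε) * s.formGamma ρ x F := by
  simp only [formGamma_eq, Finset.sum_mul, Finset.mul_sum, smul_mul_assoc, mul_smul_comm,
    ρ.gammaProd_mul_chiralProj]

section Contribution

variable (F : (x : M) → TangentSpace (mdl n) x [⋀^Fin ℓ]→ₗ[ℝ] ℂ) (ε : ℤˣ)

lemma contribution_eq_mulGamma :
    s.contribution ρ ε F = s.mulGamma ρ fun x => s.formGamma ρ x (F x) * ρ.chiralProj (-ε) :=
  funext fun x => LinearMap.ext fun X => by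
    change s.formGamma ρ x (F x) * (ρ.vec (s.comp x X) * ρ.chiralProj ε) =
      s.formGamma ρ x (F x) * ρ.chiralProj (-ε) * ρ.vec (s.comp x X)
    rw [ρ.vec_mul_chiralProj, mul_assoc]

variable {F ε} in
lemma exists_formGamma_mul_chiralProj_ne_zero (h : s.contribution ρ ε F ≠ 0) :
    ∃ x, s.formGamma ρ x (F x) * ρ.chiralProj (-ε) ≠ 0 := by
  by_contra! hzero
  refine h (funext fun x => LinearMap.ext fun X => ?_)
  rw [contribution_eq_mulGamma]
  change s.formGamma ρ x (F x) * ρ.chiralProj (-ε) * s.gamma ρ x X = 0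
  rw [hzero, zero_mul]

lemma isAdmissible_contribution_iff [T2Space M] [NeZero n] (ht : t ≤ 2 * n)
    (hC : IsChargeConjugation ρ C Δ₀ Δ₁) (hnab : IsMetricConnection g nab) :
    IsAdmissible nab C (addForm (s.leviCivita ρ nab) (s.contribution ρ ε F)) ↔
      ∀ x, s.formGamma ρ x (F x) * ρ.chiralProj (-ε) = 0 ∨
        IsAdmissibleDegree n ℓ (Δ₀ * Δ₁) := by
  have hadj (x : M) := (s.hasAdjoint_formGamma hC (F x)).mul (hC.hasAdjoint_chiralProj (-ε))
  rw [contribution_eq_mulGamma, isAdmissible_addForm_mulGamma_iff hC hnab hadj]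
  exact forall_congr' fun x => mul_chiralProj_add_hasAdjoint_eq_zero_iff hC ht (-ε)
    (s.hasAdjoint_formGamma hC (F x)) (formGamma_mul_chiralProj (F x)) (hadj x)

end Contribution

section FrameForm

variable (s) (f : M → ℝ) (i : ι) (b : Fin ℓ → Fin (2 * n))

/-- The wedge product of the one-forms `f g(e_{b_k}, ·)`, for the local frame `e` with index `i`
and a function `f`. -/
def frameForm (x : M) : TangentSpace (mdl n) x [⋀^Fin ℓ]→ₗ[ℝ] ℂ :=
  Complex.ofRealCLM.toLinearMap.compAlternatingMap
    (Matrix.detRowAlternating.compLinearMap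
      (LinearMap.pi fun k => f x • (g.val x (s.frame i (b k) x)).toLinearMap))

lemma frameForm_apply (x : M) (v : Fin ℓ → TangentSpace (mdl n) x) :
    s.frameForm f i b x v =
      ((Matrix.of fun j k => f x * g.val x (s.frame i (b k) x) (v j)).det : ℝ) := rfl

variable {f i b}

lemma isSmoothForm_frameForm (hf : ContMDiff (mdl n) 𝓘(ℝ, ℝ) ∞ f)
    (hfi : tsupport f ⊆ s.baseSet i) : IsSmoothForm (s.frameForm f i b) := by
  intro X hX
  have hentry (j k : Fin ℓ) : ContMDiff (mdl n) 𝓘(ℝ, ℝ) ∞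
      fun x => f x * g.val x (s.frame i (b k) x) (X j x) :=
    contMDiff_of_tsupport fun x hx => (hf x).smul (g.contMDiffAt
      (s.contMDiffAt_frame (hfi (tsupport_mul_subset_left hx)) (b k)) (hX j x))
  have hdet : ContDiff ℝ ∞ fun m : Fin ℓ → Fin ℓ → ℝ => (Matrix.of m).det := by
    simp only [Matrix.det_apply', Matrix.of_apply]
    fun_prop
  exact (Complex.ofRealCLM.contDiff.comp hdet).comp_contMDiff
    (contMDiff_pi_space.2 fun j => contMDiff_pi_space.2 fun k => hentry j k)

lemma frameForm_frame {x : M} (hx : x ∈ s.baseSet i) (hfx : f x = 1)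
    (a : Fin ℓ → Fin (2 * n)) :
    s.frameForm f i b x (fun k => s.frame i (a k) x) =
      ∑ σ : Equiv.Perm (Fin ℓ), if a = b ∘ σ then
        ((Equiv.Perm.sign σ : ℤ) : ℂ) * ∏ k, (sgn n t (b k) : ℂ) else 0 := by
  rw [frameForm_apply, ← Matrix.det_transpose, Matrix.det_apply', Complex.ofReal_sum]
  refine Finset.sum_congr rfl fun σ _ => ?_
  simp only [Matrix.transpose_apply, Matrix.of_apply, hfx, one_mul, s.orthonormal i x hx]
  split_ifs with h
  · subst h
    simp [Equiv.prod_comp σ fun k => (sgn n t (b k) : ℂ)]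
  · obtain ⟨k, hk⟩ : ∃ k, b (σ k) ≠ a k := by
      by_contra! h_eq
      exact h (funext fun k => (h_eq k).symm)
    rw [Finset.prod_eq_zero (Finset.mem_univ k) (if_neg hk)]
    simp

lemma formGamma_frameForm (hb : Function.Injective b) {x : M} (hfx : f x = 1) :
    s.formGamma ρ x (s.frameForm f (s.indexAt x) b x) =
      ((Nat.factorial ℓ : ℂ) * ∏ k, (sgn n t (b k) : ℂ)) • ρ.gammaProd b := by
  have hsign (σ : Equiv.Perm (Fin ℓ)) (c : ℂ) :
      (((Equiv.Perm.sign σ : ℤ) : ℂ) * c) • ρ.gammaProd (b ∘ σ) = c • ρ.gammaProd b := by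
    rw [ρ.gammaProd_comp_perm hb]
    rcases Int.units_eq_one_or (Equiv.Perm.sign σ) with h | h <;> simp [h]
  simp only [formGamma_eq, s.frameForm_frame (s.mem_baseSet_at x) hfx, Finset.sum_smul, ite_smul,
    zero_smul]
  rw [Finset.sum_comm]
  simp only [Finset.sum_ite_eq', Finset.mem_univ, if_true, hsign]
  rw [Finset.sum_const, Finset.card_univ, Fintype.card_perm, Fintype.card_fin, mul_smul,
    Nat.cast_smul_eq_nsmul]

end FrameForm

lemma exists_isSmoothForm_isUnit_formGamma [T2Space M] (s : SpinStructure ι t g)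
    (ρ : SpinorRep n t) (hℓ : ℓ ≤ 2 * n) (x : M) :
    ∃ F : (x : M) → TangentSpace (mdl n) x [⋀^Fin ℓ]→ₗ[ℝ] ℂ,
      IsSmoothForm F ∧ IsUnit (s.formGamma ρ x (F x)) := by
  obtain ⟨f, -, hf⟩ := (SmoothBumpFunction.nhds_basis_tsupport (I := mdl n) x).mem_iff.1
    (s.baseSet_mem_nhds (s.mem_baseSet_at x))
  refine ⟨s.frameForm f (s.indexAt x) (Fin.castLE hℓ), s.isSmoothForm_frameForm f.contMDiff hf, ?_⟩
  rw [s.formGamma_frameForm (Fin.castLE_injective hℓ) f.eq_one]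
  have hsgn (a : Fin (2 * n)) : (sgn n t a : ℂ) ≠ 0 :=
    Complex.ofReal_ne_zero.2 (left_ne_zero_of_mul_eq_one (sgn_mul_self a))
  have hcoeff : (Nat.factorial ℓ : ℂ) * ∏ k, (sgn n t (Fin.castLE hℓ k) : ℂ) ≠ 0 :=
    mul_ne_zero (Nat.cast_ne_zero.2 (Nat.factorial_ne_zero ℓ))
      (Finset.prod_ne_zero_iff.2 fun k _ => hsgn _)
  exact (ρ.isUnit_gammaProd _).smul (Units.mk0 _ hcoeff)

end SpinStructure

end Manifold

end SpinGeometry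

end

open SpinGeometry SpinStructure in
theorem corollary4p8_general (n t : ℕ) [NeZero n] (ht : t ≤ 2 * n)
    {M : Type*} [TopologicalSpace M] [T2Space M] [Nonempty M]
    [ChartedSpace (E n) M] [IsManifold (mdl n) ∞ M]
    (g : PseudoRiemannianMetric n M)
    (nab : TangentConnection n M) (hnab : IsMetricConnection g nab)
    {ι : Type*} (s : SpinStructure ι t g)
    (ρ : SpinorRep n t)
    (C : Spinor n →ₗ[ℂ] Spinor n →ₗ[ℂ] ℂ) (Δ₀ Δ₁ : ℤ)
    (hC : IsChargeConjugation ρ C Δ₀ Δ₁)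
    (ε : ℤˣ) (ℓ : ℕ) :
    (∀ F : (x : M) → TangentSpace (mdl n) x [⋀^Fin ℓ]→ₗ[ℝ] ℂ,
      s.contribution ρ ε F ≠ 0 →
      (IsAdmissible nab C (addForm (s.leviCivita ρ nab) (s.contribution ρ ε F)) ↔
        IsAdmissibleDegree n ℓ (Δ₀ * Δ₁))) ∧
    (ℓ ≤ 2 * n →
      ((∀ F : (x : M) → TangentSpace (mdl n) x [⋀^Fin ℓ]→ₗ[ℝ] ℂ,
        IsSmoothForm F →
        IsAdmissible nab C (addForm (s.leviCivita ρ nab) (s.contribution ρ ε F))) ↔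
        IsAdmissibleDegree n ℓ (Δ₀ * Δ₁))) := by
  have hadm := fun F => s.isAdmissible_contribution_iff (ℓ := ℓ) F ε ht hC hnab
  refine ⟨fun F hF => ?_, fun hℓ => ⟨fun h => ?_, fun h F _ => (hadm F).2 fun _ => .inr h⟩⟩
  · obtain ⟨x, hx⟩ := exists_formGamma_mul_chiralProj_ne_zero hF
    exact (hadm F).trans ⟨fun h => (h x).resolve_left hx, fun h _ => .inr h⟩
  · obtain ⟨x⟩ := ‹Nonempty M›
    obtain ⟨F, hF, hunit⟩ := s.exists_isSmoothForm_isUnit_formGamma ρ hℓ x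
    exact ((hadm F).1 (h F hF) x).resolve_left fun hzero =>
      ρ.chiralProj_ne_zero (-ε) (hunit.mul_right_eq_zero.1 hzero)

theorem corollary4p8 (n t : ℕ) (hn : 1 ≤ n) (ht : t ≤ 2 * n)
    {M : Type*} [TopologicalSpace M] [T2Space M] [SecondCountableTopology M] [Nonempty M]
    [ChartedSpace (SpinGeometry.E n) M] [IsManifold (SpinGeometry.mdl n) ∞ M]
    (g : SpinGeometry.PseudoRiemannianMetric n M)
    (nab : SpinGeometry.TangentConnection n M) (hnab : SpinGeometry.IsLeviCivita g nab)
    {ι : Type*} (s : SpinGeometry.SpinStructure ι t g)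
    (ρ : SpinGeometry.SpinorRep n t)
    (C : SpinGeometry.Spinor n →ₗ[ℂ] SpinGeometry.Spinor n →ₗ[ℂ] ℂ) (Δ₀ Δ₁ : ℤ)
    (hC : SpinGeometry.IsChargeConjugation ρ C Δ₀ Δ₁)
    (ε : ℤˣ) (ℓ : ℕ) :
    (∀ F : (x : M) → TangentSpace (SpinGeometry.mdl n) x [⋀^Fin ℓ]→ₗ[ℝ] ℂ,
      SpinGeometry.IsSmoothForm F → s.contribution ρ ε F ≠ 0 →
      (SpinGeometry.SpinStructure.IsAdmissible nab C
            (SpinGeometry.SpinStructure.addForm (s.leviCivita ρ nab) (s.contribution ρ ε F)) ↔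
        (Odd n ∧ (ℓ : ℤ) ≡ 3 [ZMOD 4]) ∨ (Even n ∧ (ℓ : ℤ) ≡ 1 + Δ₀ * Δ₁ [ZMOD 4]))) ∧
    (ℓ ≤ 2 * n →
      ((∀ F : (x : M) → TangentSpace (SpinGeometry.mdl n) x [⋀^Fin ℓ]→ₗ[ℝ] ℂ,
        SpinGeometry.IsSmoothForm F →
        SpinGeometry.SpinStructure.IsAdmissible nab C
            (SpinGeometry.SpinStructure.addForm (s.leviCivita ρ nab) (s.contribution ρ ε F))) ↔
        (Odd n ∧ (ℓ : ℤ) ≡ 3 [ZMOD 4]) ∨ (Even n ∧ (ℓ : ℤ) ≡ 1 + Δ₀ * Δ₁ [ZMOD 4]))) := by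
  have : NeZero n := ⟨Nat.one_le_iff_ne_zero.1 hn⟩
  have h := corollary4p8_general n t ht g nab hnab.metric s ρ C Δ₀ Δ₁ hC ε ℓ
  exact ⟨fun F _ => h.1 F, h.2⟩
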